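/- Let $\alpha>0$, let $X_1,\dots,X_n$ be i.i.d. random variables with density $x^{\alpha-1}e^{-x}/\Gamma(\alpha)$ on $(0,\infty)$, put $Y_i=X_i/(X_1+\dots+X_n)$ and $U=\left(\sum_{i=1}^n Y_i^2\right)^{1/2}$, and let $F_U$ be the distribution function of $U$. Let $\Phi$ be the angle in $\mathbb{R}^n$ between $(X_1,\dots,X_n)$ and $(1,\dots,1)$, so that $U=1/(\sqrt n\cos\Phi)$ almost surely, and put $\gamma_s=E\left((\cos\Phi)^s\right)$. Write $(c)_k=\prod_{i=0}^{k-1}(c+i)$ and $\binom{r}{k}=\frac{1}{k!}\prod_{i=0}^{k-1}(r-i)$. Let $$G_k(p,q;x)=\frac{\Gamma(q+k)}{\Gamma(p+2k)}\sum_{m=0}^k(-1)^m\binom km\frac{\Gamma(p+2k-m)}{\Gamma(q+k-m)}x^{k-m}$$ be the (monic) Jacobi polynomials for the weight $(1-x)^{p-q}x^{q-1}$ on $[0,1]$, and $P_k^*(x)=P_k(2x-1)$ the shifted Legendre polynomials. (a) If $n>\max\left(2,1+\frac1{2\alpha}\right)$, then $$F_U(u)=\sum_{k=0}^\infty(-1)^k(\alpha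 n+k)\binom{\alpha n+2k}{k}\left(\sum_{j=0}^k(-1)^j\frac{(\alpha n+j)_k}{j!\,(k-j)!}\,\frac{\gamma_{\alpha n+j}}{\alpha n+j}\right)G_k\left(\alpha n,\alpha n;n^{-1/2}u^{-1}\right),$$ where the series converges uniformly and absolutely on every compact interval $[a,b]\subset(1/\sqrt n,1)$. (b) If $n>\max\left(2,1+\frac1{2\alpha},\frac3{2\alpha}\right)$, then $$F_U(u)=\left(n^{1/2}u\right)^{\alpha n-1}\sum_{k=0}^\infty(-1)^k(2k+1)\left(\sum_{j=0}^k(-1)^j\frac{(k-j+1)_{2j}}{j!\,j!}\,\frac{\gamma_{\alpha n+j}}{\alpha n+j}\right)P_k^*\left(n^{-1/2}u^{-1}\right),$$ where the series converges uniformly and absolutely on every compact interval $[a,b]\subset(1/\sqrt n,1)$. -/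

import Mathlib

open MeasureTheory ProbabilityTheory Filter Finset

namespace DirichletSquareSum

noncomputable section

/-- The rising factorial `(c)_k = ∏_{i < k} (c + i)`. -/
def risingFactorial (c : ℝ) (k : ℕ) : ℝ := ∏ i ∈ range k, (c + i)

/-- The Jacobi polynomial `G_k(p, q; x)` in the normalization of Abramowitz and Stegun: the monic
polynomial of degree `k`, orthogonal on `[0, 1]` for the weight `(1 - x)^(p - q) x^(q - 1)`
(for `q > 0`, `p - q > -1`). -/
def jacobiG (k : ℕ) (p q x : ℝ) : ℝ :=
  Real.Gamma (q + k) / Real.Gamma (p + 2 * k) *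
    ∑ m ∈ range (k + 1), (-1) ^ m * (k.choose m : ℝ) *
      (Real.Gamma (p + 2 * k - m) / Real.Gamma (q + k - m)) * x ^ (k - m)

/-- The shifted Legendre polynomial `P_k^*(x) = P_k(2x - 1)`. Mathlib's `shiftedLegendre k` is
`P_k(1 - 2x)`, which differs by the sign `(-1)^k`. -/
def legendreStar (k : ℕ) (x : ℝ) : ℝ :=
  (-1) ^ k * Polynomial.aeval x (Polynomial.shiftedLegendre k)

variable {Ω : Type*} {n : ℕ}

/-- `Y_i = X_i / (X_1 + ⋯ + X_n)`. -/
def dirichletY (X : Fin n → Ω → ℝ) (i : Fin n) (ω : Ω) : ℝ := X i ω / ∑ j, X j ω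

/-- `U = (∑ Y_i²)^{1/2}`. -/
def statU (X : Fin n → Ω → ℝ) (ω : Ω) : ℝ := Real.sqrt (∑ i, dirichletY X i ω ^ 2)

/-- `Φ` is the angle in Euclidean `ℝⁿ` between `(X_1, …, X_n)` and `(1, …, 1)`. -/
def anglePhi (X : Fin n → Ω → ℝ) (ω : Ω) : ℝ :=
  InnerProductGeometry.angle (WithLp.toLp 2 (fun i => X i ω) : EuclideanSpace ℝ (Fin n))
    (WithLp.toLp 2 (fun _ => 1))

/-- `γ_s = E((cos Φ)^s)`. -/
def cosMoment [MeasurableSpace Ω] (P : Measure Ω) (X : Fin n → Ω → ℝ) (s : ℝ) : ℝ :=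
  ∫ ω, Real.cos (anglePhi X ω) ^ s ∂P

/-- The `k`-th term, at `u`, of the expansion of `F_U(u)` in Jacobi polynomials. -/
def jacobiTerm [MeasurableSpace Ω] (P : Measure Ω) (X : Fin n → Ω → ℝ) (α : ℝ) (k : ℕ)
    (u : ℝ) : ℝ :=
  (-1) ^ k * (α * n + k) * Ring.choose (α * n + 2 * k) k *
    (∑ j ∈ range (k + 1), (-1) ^ j *
      (risingFactorial (α * n + j) k / ((j.factorial : ℝ) * ((k - j).factorial : ℝ))) *
      (cosMoment P X (α * n + j) / (α * n + j))) *
    jacobiG k (α * n) (α * n) (1 / (Real.sqrt n * u))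

/-- The `k`-th term, at `u`, of the expansion of `F_U(u) / (√n u)^(α n - 1)` in shifted Legendre
polynomials. -/
def legendreTerm [MeasurableSpace Ω] (P : Measure Ω) (X : Fin n → Ω → ℝ) (α : ℝ) (k : ℕ)
    (u : ℝ) : ℝ :=
  (-1) ^ k * (2 * k + 1) *
    (∑ j ∈ range (k + 1), (-1) ^ j *
      (risingFactorial ((k : ℝ) - j + 1) (2 * j) / ((j.factorial : ℝ) * (j.factorial : ℝ))) *
      (cosMoment P X (α * n + j) / (α * n + j))) *
    legendreStar k (1 / (Real.sqrt n * u))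

/-- The function series `∑ t_k` converges to `F`, uniformly and absolutely, on the set `s`: the
partial sums converge uniformly on `s` to `F`, the series of absolute values converges at each
point of `s`, and its partial sums converge uniformly on `s` too. -/
def ConvergesUniformlyAbsolutelyOn (t : ℕ → ℝ → ℝ) (F : ℝ → ℝ) (s : Set ℝ) : Prop :=
  TendstoUniformlyOn (fun N u => ∑ k ∈ range N, t k u) F atTop s ∧
    (∀ u ∈ s, Summable (fun k => |t k u|)) ∧
    TendstoUniformlyOn (fun N u => ∑ k ∈ range N, |t k u|) (fun u => ∑' k, |t k u|) atTop s

end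

end DirichletSquareSum

/-! Let `ν` be the law of `cos Φ`. Since `U = 1 / (√n cos Φ)` almost surely, `F_U(u) = ν [x, ∞)` at
`x = 1 / (√n u)`, and `x` runs over a compact part of `(0, 1)` when `u ∈ [a, b]`. Both expansions
are Jacobi series on `[0, 1]`, for the weight `x ^ (β - 1)`, of `g(x) = x ^ τ * ν [x, ∞)`: part (a)
is `τ = 0`, `β = α n`, and part (b) is `τ = α n - 1`, `β = 1`, divided by `x ^ τ`. By Fubini the
integral of `g(x) x ^ j x ^ (β - 1)` is `γ_{τ+β+j} / (τ + β + j)`, which turns the Jacobi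
coefficients into the stated sums of moments.

Convergence rests on two facts. The analytic one (`exists_summable_bound`, `hasSum_jacobiSeries`):
the series of a continuous `g` converges to `g`, absolutely and uniformly on compact subsets of `(0,
1)`, if `|∫ g (L q) w| ≤ K (∫ x (1 - x) q'² w)^{1/2}` for all polynomials `q`, where `L` is the
Jacobi operator and `w` the weight. This is a weak form of `g' ∈ L²(x (1 - x) w)`. It makes `∑ k³
a_k²` finite for the coefficients `a_k` of `g`, while an energy argument gives `√k |p_k| ≤ C`
locally for the Jacobi polynomials `p_k`; Cauchy-Schwarz does the rest.

The probabilistic one (`exists_lintegral_cosVec_le`): `ν` has a square-integrable density, in the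
dual form `∫ φ dν ≤ K ‖φ‖₂`, which requires no formula for the density. Fix which coordinate `x` is
the largest and freeze the others, `z`. The cosine is then strictly decreasing in `x`, so a change
of variables and Cauchy-Schwarz bound the conditional integral by `‖φ‖₂` times the root of `∫ f² /
|∂ₓ cos|`, where `f` is the gamma density. Integrability over `z` needs `n ≥ 3` and `α > 1 / (2 (n -
1))`.

Applied to the tail function, integration by parts moves `L q` onto `ν`, and the `L²` bound yields
the weak-derivative hypothesis; the factor `x ^ τ` adds one more term, controlled when `2 τ + β ≥
2`, that is, `α n ≥ 3/2` in part (b). -/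

namespace JacobiSeries

/-! ### Jacobi polynomials: differential equation, value at `1`, spanning. -/

open Polynomial

/-- The Jacobi polynomial for the weight `x ^ (β - 1)` on `[0, 1]` whose value at `1` is
`(-1) ^ k`. -/
noncomputable def jacobiPoly (β : ℝ) (k : ℕ) : ℝ[X] :=
  ∑ j ∈ range (k + 1), monomial j
    ((-1) ^ j * (k.choose j : ℝ) * (ascPochhammer ℝ k).eval (β + j) / (k.factorial : ℝ))

/-- The differential operator `q ↦ x (1 - x) q'' + (β - (β + 1) x) q'`. -/
noncomputable def jacobiOp (β : ℝ) (q : ℝ[X]) : ℝ[X] :=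
  X * (1 - X) * derivative (derivative q) + (C β - C (β + 1) * X) * derivative q

theorem coeff_jacobiPoly (β : ℝ) (k j : ℕ) : (jacobiPoly β k).coeff j =
    (-1) ^ j * (k.choose j : ℝ) * (ascPochhammer ℝ k).eval (β + j) / (k.factorial : ℝ) := by
  unfold jacobiPoly
  rw [finsetSum_coeff]
  simp only [coeff_monomial]
  rw [Finset.sum_ite_eq']
  split_ifs with h
  · rfl
  · rw [Nat.choose_eq_zero_of_lt (by simpa using h)]; simp

theorem ascPochhammer_eval_shift (k : ℕ) (x : ℝ) :
    x * (ascPochhammer ℝ k).eval (x + 1) = (ascPochhammer ℝ k).eval x * (x + k) := by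
  rw [← ascPochhammer_succ_eval, ascPochhammer_succ_left]
  simp

/-- The ratio of consecutive coefficients with denominators cleared, so that it also holds at and
beyond the degree. It is the Jacobi differential equation read coefficientwise. -/
theorem coeff_jacobiPoly_succ (β : ℝ) (k j : ℕ) :
    (jacobiPoly β k).coeff (j + 1) * ((j + 1) * (j + β)) =
      (jacobiPoly β k).coeff j * ((j - k) * (j + k + β)) := by
  rw [coeff_jacobiPoly, coeff_jacobiPoly]
  have h1 : (k.choose (j + 1) : ℝ) * (j + 1) = k.choose j * (k - j) := by
    rcases le_or_gt j k with h | h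
    · have := Nat.choose_succ_right_eq k j
      rw [← Nat.cast_sub h]; exact_mod_cast this
    · rw [Nat.choose_eq_zero_of_lt h, Nat.choose_eq_zero_of_lt (by omega)]; simp
  have h2 := ascPochhammer_eval_shift k (β + j)
  push_cast
  rw [show β + ((j : ℝ) + 1) = β + j + 1 by ring, pow_succ]
  have hk : (k.factorial : ℝ) ≠ 0 := by positivity
  field_simp
  linear_combination (-(j + β) * (ascPochhammer ℝ k).eval (β + j + 1)) * h1
    - (k.choose j * (k - j)) * h2

/-- If `q = ∑ c_j x ^ j`, the coefficient of `x ^ j` in `jacobiOp β q` is `(j + 1)(j + β) c_{j+1} -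
j (j + β) c_j`. As `j (j + β) - k (k + β) = (j - k)(j + k + β)`, the eigenvalue equation is exactly
the two-term recurrence. -/
theorem jacobiOp_jacobiPoly (β : ℝ) (k : ℕ) :
    jacobiOp β (jacobiPoly β k) = C (-(k * (k + β))) * jacobiPoly β k := by
  ext j
  have h := coeff_jacobiPoly_succ β k j
  have e : jacobiOp β (jacobiPoly β k) =
      X * derivative (derivative (jacobiPoly β k))
      - X * (X * derivative (derivative (jacobiPoly β k)))
      + C β * derivative (jacobiPoly β k)
      - C (β + 1) * (X * derivative (jacobiPoly β k)) := by
    unfold jacobiOp; ring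
  rw [e]
  simp only [coeff_sub, coeff_add, coeff_C_mul]
  rcases j with _ | _ | j
  · simp [coeff_derivative] at h ⊢
    linear_combination h
  · simp [coeff_derivative, coeff_X_mul] at h ⊢
    linear_combination h
  · simp only [coeff_X_mul, coeff_derivative] at h ⊢
    push_cast at h ⊢
    linear_combination h

theorem jacobiPoly_eval (β : ℝ) (k : ℕ) (x : ℝ) : (jacobiPoly β k).eval x =
    ∑ j ∈ range (k + 1), (-1) ^ j * (k.choose j : ℝ) * (ascPochhammer ℝ k).eval (β + j) /
      (k.factorial : ℝ) * x ^ j := by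
  simp [jacobiPoly, eval_finsetSum]

/-- Up to the sign and `k!`, the sum is the `k`-th finite difference at `0` of the monic polynomial
`(β + x)_k` of degree `k`, which equals `k!`. -/
theorem jacobiPoly_eval_one (β : ℝ) (k : ℕ) : (jacobiPoly β k).eval 1 = (-1) ^ k := by
  set P : ℝ[X] := (ascPochhammer ℝ k).comp (X + C β) with hP
  have hmon : P.Monic := (monic_ascPochhammer ℝ k).comp_X_add_C β
  have hdeg : P.natDegree = k := by
    rw [hP, natDegree_comp, ascPochhammer_natDegree, natDegree_X_add_C, mul_one]
  have h1 := P.fwdDiff_iter_degree_eq_factorial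
  rw [hdeg, hmon.leadingCoeff] at h1
  have h2 := congrFun h1 0
  rw [fwdDiff_iter_eq_sum_shift] at h2
  rw [jacobiPoly_eval]
  have hk : (k.factorial : ℝ) ≠ 0 := by positivity
  simp only [one_pow, mul_one, ← Finset.sum_div]
  rw [div_eq_iff hk]
  have h3 : (k.factorial : ℝ) = ∑ j ∈ range (k + 1),
      ((-1 : ℤ) ^ (k - j) * (k.choose j : ℤ)) • eval (0 + j • (1 : ℝ)) P := by
    rw [h2]; simp
  rw [h3, Finset.mul_sum]
  refine Finset.sum_congr rfl fun j hj => ?_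
  have hj' : j ≤ k := by simpa [Nat.lt_succ_iff] using hj
  simp only [hP, eval_comp, eval_add, eval_X, eval_C, zero_add, nsmul_eq_mul, mul_one,
    zsmul_eq_mul]
  push_cast
  rw [add_comm (j : ℝ) β, ← mul_assoc, ← mul_assoc]
  congr 2
  obtain ⟨m, rfl⟩ := Nat.exists_eq_add_of_le hj'
  rw [Nat.add_sub_cancel_left, ← pow_add, show j + m + m = j + 2 * m by ring, pow_add, pow_mul]
  simp

theorem natDegree_jacobiPoly_le (β : ℝ) (k : ℕ) : (jacobiPoly β k).natDegree ≤ k := by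
  rw [natDegree_le_iff_coeff_eq_zero]
  intro j hj
  rw [coeff_jacobiPoly, Nat.choose_eq_zero_of_lt hj]; simp

theorem coeff_jacobiPoly_self_ne_zero {β : ℝ} (hβ : 0 < β) (k : ℕ) :
    (jacobiPoly β k).coeff k ≠ 0 := by
  rw [coeff_jacobiPoly]
  have := ascPochhammer_pos k (β + k) (by positivity)
  have hk : (k.factorial : ℝ) ≠ 0 := by positivity
  simp [this.ne', hk]

/-- Every polynomial is a linear combination of Jacobi polynomials. -/
theorem mem_span_jacobiPoly {β : ℝ} (hβ : 0 < β) (P : ℝ[X]) :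
    ∃ N, P ∈ Submodule.span ℝ (jacobiPoly β '' (range N : Set ℕ)) := by
  suffices H : ∀ N (P : ℝ[X]), P.natDegree < N →
      P ∈ Submodule.span ℝ (jacobiPoly β '' (range N : Set ℕ)) from
    ⟨P.natDegree + 1, H _ P (Nat.lt_succ_self _)⟩
  intro N
  induction N with
  | zero => intro P h; omega
  | succ N ih =>
    intro P h
    set a := P.coeff N / (jacobiPoly β N).coeff N
    have hmono : Submodule.span ℝ (jacobiPoly β '' (range N : Set ℕ)) ≤
        Submodule.span ℝ (jacobiPoly β '' (range (N + 1) : Set ℕ)) :=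
      Submodule.span_mono (Set.image_mono (by
        exact_mod_cast Finset.range_subset_range.2 (Nat.le_succ N)))
    have hN : jacobiPoly β N ∈ Submodule.span ℝ (jacobiPoly β '' (range (N + 1) : Set ℕ)) :=
      Submodule.subset_span ⟨N, by simp, rfl⟩
    have hsplit : P = (P - a • jacobiPoly β N) + a • jacobiPoly β N := by abel
    rw [hsplit]
    refine Submodule.add_mem _ ?_ (Submodule.smul_mem _ _ hN)
    -- For `N = 0` subtracting the leading term leaves zero, whose `natDegree` is not less than `0`;
    -- the induction hypothesis cannot be used there.
    rcases Nat.eq_zero_or_pos N with rfl | hN0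
    · have : P - a • jacobiPoly β 0 = 0 := by
        rw [eq_C_of_natDegree_eq_zero (show P.natDegree = 0 by omega),
          eq_C_of_natDegree_eq_zero (show (jacobiPoly β 0).natDegree = 0 from
            Nat.le_zero.1 (natDegree_jacobiPoly_le β 0)), smul_C, ← C_sub]
        simp only [a, smul_eq_mul]
        rw [div_mul_cancel₀ _ (coeff_jacobiPoly_self_ne_zero hβ 0)]; simp
      rw [this]; exact Submodule.zero_mem _
    · apply hmono
      apply ih
      have hle : (P - a • jacobiPoly β N).natDegree ≤ N :=
        (natDegree_sub_le _ _).trans (max_le (by omega)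
          ((natDegree_smul_le _ _).trans (natDegree_jacobiPoly_le β N)))
      refine lt_of_le_of_ne hle fun heq => ?_
      have hc : (P - a • jacobiPoly β N).coeff N = 0 := by
        simp only [coeff_sub, coeff_smul, smul_eq_mul, a]
        rw [div_mul_cancel₀ _ (coeff_jacobiPoly_self_ne_zero hβ N), sub_self]
      have : (P - a • jacobiPoly β N).leadingCoeff = 0 := by rw [leadingCoeff, heq, hc]
      rw [leadingCoeff_eq_zero] at this
      rw [this] at heq; simp at heq; omega

end JacobiSeries

/-! ### Weighted integrals, Green's formula and orthogonality. -/

namespace JacobiSeries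

open Polynomial

theorem intervalIntegrable_mul_rpow {s c : ℝ} (hs : 0 < s) {h : ℝ → ℝ}
    (hh : ContinuousOn h (Set.uIcc 0 c)) :
    IntervalIntegrable (fun x => h x * x ^ (s - 1)) volume 0 c :=
  (intervalIntegral.intervalIntegrable_rpow' (by linarith)).continuousOn_mul hh

/-- The integrand is the derivative of `x ^ s R(x)`. Only `s > 0` is needed: the boundary term at
`0` vanishes and the possible singularity there is integrable. -/
theorem integral_deriv_polynomial_mul_rpow {s c : ℝ} (hs : 0 < s) (hc : 0 ≤ c) (R : ℝ[X]) :
    ∫ x in (0 : ℝ)..c, (s * R.eval x + x * (derivative R).eval x) * x ^ (s - 1) =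
      c ^ s * R.eval c := by
  have h := intervalIntegral.integral_eq_sub_of_hasDerivAt_of_le (a := 0) (b := c)
    (f := fun x => x ^ s * R.eval x)
    (f' := fun x => (s * R.eval x + x * (derivative R).eval x) * x ^ (s - 1)) hc ?_ ?_ ?_
  · rw [h]; simp [Real.zero_rpow hs.ne']
  · exact ((Real.continuous_rpow_const hs.le).mul R.continuous).continuousOn
  · intro x hx
    have h1 := (Real.hasDerivAt_rpow_const (x := x) (p := s) (Or.inl hx.1.ne')).mul (R.hasDerivAt x)
    refine h1.congr_deriv ?_
    have : x ^ s = x * x ^ (s - 1) := by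
      rw [Real.rpow_sub_one hx.1.ne']; field_simp [hx.1.ne']
    rw [this]; ring
  · exact intervalIntegrable_mul_rpow hs (by fun_prop)

/-- The linear functional `p ↦ ∫₀¹ g(x) p(x) x ^ (β - 1) dx` on polynomials. -/
noncomputable def pairing {β : ℝ} (hβ : 0 < β) {g : ℝ → ℝ} (hg : ContinuousOn g (Set.Icc 0 1)) :
    ℝ[X] →ₗ[ℝ] ℝ where
  toFun p := ∫ x in (0 : ℝ)..1, (g x * p.eval x) * x ^ (β - 1)
  map_add' p q := by
    rw [← intervalIntegral.integral_add]
    · congr 1; ext x; simp only [eval_add]; ring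
    · exact intervalIntegrable_mul_rpow hβ
        ((by simpa using hg : ContinuousOn g (Set.uIcc 0 1)).mul p.continuous.continuousOn)
    · exact intervalIntegrable_mul_rpow hβ
        ((by simpa using hg : ContinuousOn g (Set.uIcc 0 1)).mul q.continuous.continuousOn)
  map_smul' a p := by
    rw [RingHom.id_apply, smul_eq_mul, ← intervalIntegral.integral_const_mul]
    congr 1; ext x; simp only [eval_smul, smul_eq_mul]; ring

theorem pairing_apply {β : ℝ} (hβ : 0 < β) {g : ℝ → ℝ} (hg : ContinuousOn g (Set.Icc 0 1))
    (p : ℝ[X]) : pairing hβ hg p = ∫ x in (0 : ℝ)..1, (g x * p.eval x) * x ^ (β - 1) := rfl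

/-- The weighted integral `∫₀¹ p(x) x ^ (β - 1) dx` of a polynomial. -/
noncomputable def weightInt {β : ℝ} (hβ : 0 < β) : ℝ[X] →ₗ[ℝ] ℝ :=
  pairing hβ (g := fun _ => 1) continuousOn_const

theorem weightInt_apply {β : ℝ} (hβ : 0 < β) (p : ℝ[X]) :
    weightInt hβ p = ∫ x in (0 : ℝ)..1, p.eval x * x ^ (β - 1) := by
  simp [weightInt, pairing_apply]

theorem pairing_polynomial {β : ℝ} (hβ : 0 < β) (p q : ℝ[X]) :
    pairing hβ (g := fun x => p.eval x) p.continuous.continuousOn q = weightInt hβ (p * q) := by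
  simp [weightInt_apply, pairing_apply]

theorem weightInt_deriv {β : ℝ} (hβ : 0 < β) (R : ℝ[X]) :
    weightInt hβ (C β * R + X * derivative R) = R.eval 1 := by
  have := integral_deriv_polynomial_mul_rpow hβ zero_le_one R
  rw [weightInt_apply]
  simpa using this

/-- Green's formula for the Jacobi operator. -/
theorem weightInt_jacobiOp_mul {β : ℝ} (hβ : 0 < β) (q r : ℝ[X]) :
    weightInt hβ (jacobiOp β q * r) =
      - weightInt hβ (X * (1 - X) * derivative q * derivative r) := by
  have h := weightInt_deriv hβ ((1 - X) * derivative q * r)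
  rw [← add_eq_zero_iff_eq_neg, ← map_add]
  simp only [eval_mul, eval_sub, eval_one, eval_X, sub_self, zero_mul] at h
  rw [← h]
  congr 1
  simp only [jacobiOp, derivative_mul, derivative_sub, derivative_one, derivative_X, C_add, C_1]
  ring

/-- Green's formula makes the operator symmetric, and it sends `x ^ m` to a combination of `x ^ (m -
1)` and `x ^ m`. Comparison with the eigenvalue of `jacobiPoly β k` expresses the `m`-th integral
through the previous one, with a factor that is nonzero for `m < k`. -/
theorem weightInt_X_pow_mul_jacobiPoly {β : ℝ} (hβ : 0 < β) {k m : ℕ} (hm : m < k) :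
    weightInt hβ (X ^ m * jacobiPoly β k) = 0 := by
  have hL : ∀ m : ℕ, jacobiOp β (X ^ m : ℝ[X]) =
      (m * (m - 1 + β) : ℝ) • (X ^ (m - 1) : ℝ[X]) - (m * (m + β) : ℝ) • (X ^ m : ℝ[X]) := by
    intro m
    rcases m with _ | _ | m
    · simp [jacobiOp]
    · simp only [jacobiOp, smul_eq_C_mul]; simp; ring
    · simp only [jacobiOp, smul_eq_C_mul]
      simp
      ring
  have key : ∀ m : ℕ, ((k : ℝ) * (k + β) - m * (m + β)) * weightInt hβ (X ^ m * jacobiPoly β k) =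
      - (m * (m - 1 + β)) * weightInt hβ (X ^ (m - 1) * jacobiPoly β k) := by
    intro m
    have h1 := weightInt_jacobiOp_mul hβ (jacobiPoly β k) (X ^ m)
    have h2 := weightInt_jacobiOp_mul hβ (X ^ m) (jacobiPoly β k)
    rw [show X * (1 - X) * derivative (X ^ m : ℝ[X]) * derivative (jacobiPoly β k) =
      X * (1 - X) * derivative (jacobiPoly β k) * derivative (X ^ m : ℝ[X]) by ring, ← h1,
      jacobiOp_jacobiPoly, hL, sub_mul, map_sub, smul_mul_assoc, smul_mul_assoc, map_smul,
      map_smul, mul_assoc (C _), ← smul_eq_C_mul, map_smul,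
      mul_comm (jacobiPoly β k)] at h2
    simp only [smul_eq_mul] at h2
    linear_combination h2
  have pos : ∀ m : ℕ, m < k → (k : ℝ) * (k + β) - m * (m + β) ≠ 0 := by
    intro m hm
    have : (m : ℝ) < k := by exact_mod_cast hm
    have h0 : (0 : ℝ) ≤ m := by positivity
    have : 0 < (k : ℝ) * (k + β) - m * (m + β) := by nlinarith
    exact this.ne'
  induction m with
  | zero =>
    have := key 0
    simp only [Nat.cast_zero, zero_mul, neg_zero] at this
    have hp := pos 0 hm
    simp only [Nat.cast_zero, zero_mul] at hp
    exact (mul_eq_zero.1 this).resolve_left hp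
  | succ m ih =>
    have := key (m + 1)
    rw [Nat.add_sub_cancel, ih (by omega), mul_zero] at this
    exact (mul_eq_zero.1 this).resolve_left (pos _ hm)

/-- The degree condition is put on coefficients so that `k = 0` is allowed, with `r = 0`. -/
theorem weightInt_mul_jacobiPoly_of_natDegree_lt {β : ℝ} (hβ : 0 < β) {k : ℕ} {r : ℝ[X]}
    (hr : ∀ j, k ≤ j → r.coeff j = 0) : weightInt hβ (r * jacobiPoly β k) = 0 := by
  rw [r.as_sum_range_C_mul_X_pow, Finset.sum_mul, map_sum]
  refine Finset.sum_eq_zero fun j _ => ?_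
  rw [mul_assoc, ← smul_eq_C_mul, map_smul]
  rcases lt_or_ge j k with h | h
  · rw [weightInt_X_pow_mul_jacobiPoly hβ h, smul_zero]
  · rw [hr j h, zero_smul]

/-- For the norm of `p = jacobiPoly β k`, integrating the derivative of `x ^ β p²` gives `β ∫ p² + 2
∫ x p' p = p(1)² = 1` against the weight. Since `x p' - k p` has no terms of degree `k` or more, it
is orthogonal to `p`, and the second integral is `k ∫ p²`. -/
theorem weightInt_jacobiPoly_mul {β : ℝ} (hβ : 0 < β) (k l : ℕ) :
    weightInt hβ (jacobiPoly β k * jacobiPoly β l) = if k = l then 1 / (β + 2 * k) else 0 := by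
  have off : ∀ k l : ℕ, k < l → weightInt hβ (jacobiPoly β k * jacobiPoly β l) = 0 := by
    intro k l h
    refine weightInt_mul_jacobiPoly_of_natDegree_lt hβ fun j hj => ?_
    exact coeff_eq_zero_of_natDegree_lt ((natDegree_jacobiPoly_le β k).trans_lt (by omega))
  split_ifs with h
  · subst h
    have h1 := weightInt_deriv hβ (jacobiPoly β k * jacobiPoly β k)
    have h2 : weightInt hβ ((X * derivative (jacobiPoly β k) - (k : ℝ) • jacobiPoly β k) *
        jacobiPoly β k) = 0 := by
      refine weightInt_mul_jacobiPoly_of_natDegree_lt hβ fun j hj => ?_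
      rcases j with _ | j
      · obtain rfl : k = 0 := by omega
        simp
      · rw [coeff_sub, coeff_X_mul, coeff_derivative, coeff_smul, smul_eq_mul]
        rcases Nat.eq_or_lt_of_le hj with h | h
        · rw [h]; push_cast; ring
        · rw [coeff_jacobiPoly, Nat.choose_eq_zero_of_lt h]; simp
    rw [sub_mul, map_sub, smul_mul_assoc, map_smul, smul_eq_mul] at h2
    have e : C β * (jacobiPoly β k * jacobiPoly β k) +
        X * derivative (jacobiPoly β k * jacobiPoly β k) =
        β • (jacobiPoly β k * jacobiPoly β k) +
          (2 : ℝ) • (X * derivative (jacobiPoly β k) * jacobiPoly β k) := by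
      rw [smul_eq_C_mul, smul_eq_C_mul, derivative_mul, show (C (2 : ℝ)) = 2 from rfl]; ring
    rw [e, map_add, map_smul, map_smul, eval_mul, jacobiPoly_eval_one, ← mul_pow] at h1
    simp only [smul_eq_mul, neg_mul_neg, one_mul, one_pow] at h1
    rw [eq_div_iff (by positivity)]
    linear_combination h1 - 2 * h2
  · rcases Nat.lt_or_gt_of_ne h with h | h
    · exact off k l h
    · rw [mul_comm]; exact off l k h

theorem weightInt_deriv_jacobiPoly_sq {β : ℝ} (hβ : 0 < β) (k : ℕ) :
    weightInt hβ (X * (1 - X) * derivative (jacobiPoly β k) * derivative (jacobiPoly β k)) =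
      k * (k + β) / (β + 2 * k) := by
  have := weightInt_jacobiOp_mul hβ (jacobiPoly β k) (jacobiPoly β k)
  rw [jacobiOp_jacobiPoly, mul_assoc, ← smul_eq_C_mul, map_smul, weightInt_jacobiPoly_mul,
    if_pos rfl, smul_eq_mul] at this
  linear_combination this

end JacobiSeries

/-! ### Local bounds for the orthonormal Jacobi polynomials. -/

namespace JacobiSeries

open Polynomial

/-- Grönwall in both directions: `f e^{Mx}` increases and `f e^{-Mx}` decreases, so any two values
of `f` on the interval are comparable. -/
theorem le_exp_mul_of_abs_deriv_le {f f' : ℝ → ℝ} {c d M : ℝ}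
    (hf : ∀ x, HasDerivAt f (f' x) x) (hM : ∀ x ∈ Set.Icc c d, |f' x| ≤ M * f x)
    (hM0 : 0 ≤ M) (hf0 : ∀ x ∈ Set.Icc c d, 0 ≤ f x) {x t : ℝ} (hx : x ∈ Set.Icc c d)
    (ht : t ∈ Set.Icc c d) : f x ≤ Real.exp (M * (d - c)) * f t := by
  have hder : ∀ (a x : ℝ), HasDerivAt (fun x => f x * Real.exp (a * x))
      ((f' x + a * f x) * Real.exp (a * x)) x := by
    intro a x
    have h2 : HasDerivAt (fun x => Real.exp (a * x)) (Real.exp (a * x) * (a * 1)) x :=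
      ((hasDerivAt_id x).const_mul a).exp
    exact ((hf x).mul h2).congr_deriv (by ring)
  have hcont : ∀ a : ℝ, ContinuousOn (fun x => f x * Real.exp (a * x)) (Set.Icc c d) :=
    fun a x _ => (hder a x).continuousAt.continuousWithinAt
  have key : f x ≤ Real.exp (M * |t - x|) * f t := by
    rcases le_total x t with h | h
    · have mono : MonotoneOn (fun x => f x * Real.exp (M * x)) (Set.Icc c d) := by
        refine monotoneOn_of_deriv_nonneg (convex_Icc c d) (hcont M)
          (fun y _ => (hder M y).differentiableAt.differentiableWithinAt) fun y hy => ?_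
        rw [(hder M y).deriv]
        have := (abs_le.1 (hM y (interior_subset hy))).1
        exact mul_nonneg (by linarith) (Real.exp_pos _).le
      have := mono hx ht h
      simp only at this
      rw [abs_of_nonneg (sub_nonneg.2 h), mul_sub, Real.exp_sub, div_mul_eq_mul_div,
        le_div_iff₀ (Real.exp_pos _)]
      linarith
    · have anti : AntitoneOn (fun x => f x * Real.exp ((-M) * x)) (Set.Icc c d) := by
        refine antitoneOn_of_deriv_nonpos (convex_Icc c d) (hcont (-M))
          (fun y _ => (hder (-M) y).differentiableAt.differentiableWithinAt) fun y hy => ?_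
        rw [(hder (-M) y).deriv]
        have := (abs_le.1 (hM y (interior_subset hy))).2
        exact mul_nonpos_of_nonpos_of_nonneg (by linarith) (Real.exp_pos _).le
      have := anti ht hx h
      simp only [neg_mul, Real.exp_neg] at this
      rw [abs_of_nonpos (sub_nonpos.2 h), show M * -(t - x) = M * x - M * t by ring, Real.exp_sub,
        div_mul_eq_mul_div, le_div_iff₀ (Real.exp_pos _)]
      rw [← div_eq_mul_inv, ← div_eq_mul_inv, div_le_div_iff₀ (Real.exp_pos _)
        (Real.exp_pos _)] at this
      linarith
  refine key.trans (mul_le_mul_of_nonneg_right (Real.exp_le_exp.2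
    (mul_le_mul_of_nonneg_left ?_ hM0)) (hf0 t ht))
  rw [abs_le]; constructor <;> linarith [hx.1, hx.2, ht.1, ht.2]

/-- The energy of a Jacobi polynomial. -/
noncomputable def energy (β : ℝ) (k : ℕ) : ℝ[X] :=
  jacobiPoly β k * jacobiPoly β k + (1 / (k * (k + β)) : ℝ) •
    (X * (1 - X) * derivative (jacobiPoly β k) * derivative (jacobiPoly β k))

theorem energy_eval (β : ℝ) (k : ℕ) (x : ℝ) : (energy β k).eval x =
    (jacobiPoly β k).eval x ^ 2 +
      1 / (k * (k + β)) * (x * (1 - x) * (derivative (jacobiPoly β k)).eval x ^ 2) := by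
  simp [energy]; ring

/-- The constant `1 / (k (k + β))` in the energy is chosen so that the differential equation cancels
the term in `p p'`. What remains has only `p'²`, with a coefficient that the energy dominates away
from the endpoints, uniformly in `k`. -/
theorem derivative_energy_eval {β : ℝ} (hβ : 0 < β) {k : ℕ} (hk : k ≠ 0) (x : ℝ) :
    (derivative (energy β k)).eval x =
      1 / (k * (k + β)) * ((1 - 2 * β + 2 * β * x) *
        (derivative (jacobiPoly β k)).eval x ^ 2) := by
  have hode := congrArg (eval x) (jacobiOp_jacobiPoly β k)
  simp [jacobiOp] at hode
  simp only [energy, derivative_add, derivative_mul, derivative_smul, eval_add, eval_mul, eval_smul,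
    derivative_sub, derivative_X, derivative_one, eval_X, eval_one, eval_sub, eval_zero,
    smul_eq_mul]
  have hk' : (k : ℝ) ≠ 0 := by exact_mod_cast hk
  have hkb : (k : ℝ) + β ≠ 0 := by positivity
  field_simp
  linear_combination (2 * (derivative (jacobiPoly β k)).eval x) * hode

theorem weightInt_energy {β : ℝ} (hβ : 0 < β) {k : ℕ} (hk : k ≠ 0) :
    weightInt hβ (energy β k) = 2 / (β + 2 * k) := by
  have hk' : (k : ℝ) ≠ 0 := by exact_mod_cast hk
  have hkb : (k : ℝ) + β ≠ 0 := by positivity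
  have h2 : β + 2 * (k : ℝ) ≠ 0 := by positivity
  rw [energy, map_add, map_smul, weightInt_deriv_jacobiPoly_sq, weightInt_jacobiPoly_mul,
    if_pos rfl, smul_eq_mul]
  field_simp
  norm_num

/-- The orthonormal Jacobi polynomials are uniformly bounded on compact subintervals. -/
theorem exists_bound_jacobiPoly {β : ℝ} (hβ : 0 < β) {c d : ℝ} (hc : 0 < c) (hcd : c < d)
    (hd : d < 1) : ∃ C : ℝ, 0 ≤ C ∧ ∀ (k : ℕ), ∀ x ∈ Set.Icc c d,
      (β + 2 * k) * (jacobiPoly β k).eval x ^ 2 ≤ C := by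
  -- On `[c, d]`, `|1 - 2β + 2βx| ≤ 1 + 2β` and `x (1 - x) ≥ c (1 - d)`; so `|E'| ≤ M E` for the
  -- energy `E`, with `M` independent of `k`.
  set M := (1 + 2 * β) / (c * (1 - d)) with hM
  have hcd' : 0 < c * (1 - d) := mul_pos hc (by linarith)
  have hM0 : 0 ≤ M := by positivity
  set W := ∫ x in c..d, x ^ (β - 1) with hW
  have hWint : IntervalIntegrable (fun x : ℝ => x ^ (β - 1)) volume c d :=
    intervalIntegral.intervalIntegrable_rpow' (by linarith)
  have hWpos : 0 < W := by
    refine intervalIntegral.intervalIntegral_pos_of_pos_on hWint (fun x hx => ?_) hcd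
    exact Real.rpow_pos_of_pos (hc.trans hx.1) _
  -- The summand `β` covers `k = 0`. For `k > 0`, averaging the Grönwall comparison over `[c, d]`
  -- against the weight bounds the energy at `x` by its total integral `2 / (β + 2k)`.
  refine ⟨β + Real.exp (M * (d - c)) * 2 / W, by positivity, fun k x hx => ?_⟩
  rcases Nat.eq_zero_or_pos k with rfl | hk
  · simp [jacobiPoly]; positivity
  have hlam : 0 < 1 / ((k : ℝ) * (k + β)) := by positivity
  have hx01 : ∀ y ∈ Set.Icc c d, 0 < y ∧ 0 < 1 - y := fun y hy =>
    ⟨hc.trans_le hy.1, by linarith [hy.2]⟩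
  have hE0 : ∀ y ∈ Set.Icc (0 : ℝ) 1, 0 ≤ (energy β k).eval y := by
    intro y hy
    have := hy.1
    have := sub_nonneg.2 hy.2
    rw [energy_eval]; positivity
  have hsub : Set.Icc c d ⊆ Set.Icc 0 1 := Set.Icc_subset_Icc hc.le hd.le
  have hder : ∀ y ∈ Set.Icc c d,
      |(derivative (energy β k)).eval y| ≤ M * (energy β k).eval y := by
    intro y hy
    obtain ⟨h0, h1⟩ := hx01 y hy
    rw [derivative_energy_eval hβ hk.ne', energy_eval, abs_mul, abs_of_pos hlam, abs_mul, abs_sq]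
    set D := (derivative (jacobiPoly β k)).eval y ^ 2
    have hD : 0 ≤ D := sq_nonneg _
    have e1 : |1 - 2 * β + 2 * β * y| ≤ 1 + 2 * β := by
      rw [abs_le]; constructor <;> nlinarith
    have e2 : c * (1 - d) ≤ y * (1 - y) :=
      mul_le_mul hy.1 (by linarith [hy.2]) (by linarith) h0.le
    have e3 : 1 + 2 * β ≤ M * (y * (1 - y)) := by
      calc 1 + 2 * β = M * (c * (1 - d)) := by rw [hM, div_mul_cancel₀ _ hcd'.ne']
        _ ≤ _ := mul_le_mul_of_nonneg_left e2 hM0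
    have e4 : |1 - 2 * β + 2 * β * y| * D ≤ M * (y * (1 - y)) * D :=
      mul_le_mul_of_nonneg_right (e1.trans e3) hD
    have e5 := mul_le_mul_of_nonneg_left e4 hlam.le
    have e6 : 0 ≤ M * (jacobiPoly β k).eval y ^ 2 := by positivity
    linarith
  have hgron : ∀ t ∈ Set.Icc c d,
      (energy β k).eval x ≤ Real.exp (M * (d - c)) * (energy β k).eval t := fun t ht =>
    le_exp_mul_of_abs_deriv_le (fun y => (energy β k).hasDerivAt y) hder hM0
      (fun y hy => hE0 y (hsub hy)) hx ht
  have hint : IntervalIntegrable (fun t => (energy β k).eval t * t ^ (β - 1)) volume 0 1 :=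
    intervalIntegrable_mul_rpow hβ (energy β k).continuous.continuousOn
  have hint' : IntervalIntegrable (fun t => (energy β k).eval t * t ^ (β - 1)) volume c d :=
    hint.mono_set (by rw [Set.uIcc_of_le hcd.le, Set.uIcc_of_le zero_le_one]; exact hsub)
  have h1 : ∫ t in c..d, (energy β k).eval t * t ^ (β - 1) ≤ 2 / (β + 2 * k) := by
    rw [← weightInt_energy hβ hk.ne', weightInt_apply]
    refine intervalIntegral.integral_mono_interval hc.le hcd.le hd.le ?_ hint
    refine (ae_restrict_iff' measurableSet_Ioc).2 (Eventually.of_forall fun t ht => ?_)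
    exact mul_nonneg (hE0 t ⟨ht.1.le, ht.2⟩) (Real.rpow_nonneg ht.1.le _)
  have h2 : (energy β k).eval x * W ≤ Real.exp (M * (d - c)) *
      ∫ t in c..d, (energy β k).eval t * t ^ (β - 1) := by
    rw [hW, ← intervalIntegral.integral_const_mul, ← intervalIntegral.integral_const_mul]
    refine intervalIntegral.integral_mono_on hcd.le (hWint.const_mul _) (hint'.const_mul _)
      fun t ht => ?_
    rw [← mul_assoc]
    exact mul_le_mul_of_nonneg_right (hgron t ht) (Real.rpow_nonneg (hx01 t ht).1.le _)
  have h3 : (jacobiPoly β k).eval x ^ 2 ≤ (energy β k).eval x := by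
    obtain ⟨h0, h1⟩ := hx01 x hx
    rw [energy_eval]
    have : 0 ≤ 1 / (k * (k + β)) * (x * (1 - x) *
      (derivative (jacobiPoly β k)).eval x ^ 2) := by positivity
    linarith
  have hb : 0 < β + 2 * (k : ℝ) := by positivity
  have h4 : (jacobiPoly β k).eval x ^ 2 * W ≤ Real.exp (M * (d - c)) * (2 / (β + 2 * k)) :=
    (mul_le_mul_of_nonneg_right h3 hWpos.le).trans
      (h2.trans (mul_le_mul_of_nonneg_left h1 (Real.exp_pos _).le))
  have h5 : (β + 2 * k) * (jacobiPoly β k).eval x ^ 2 ≤ Real.exp (M * (d - c)) * 2 / W := by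
    rw [le_div_iff₀ hWpos]
    calc _ = (β + 2 * k) * ((jacobiPoly β k).eval x ^ 2 * W) := by ring
      _ ≤ (β + 2 * k) * (Real.exp (M * (d - c)) * (2 / (β + 2 * k))) :=
        mul_le_mul_of_nonneg_left h4 hb.le
      _ = _ := by field_simp
  linarith

end JacobiSeries

/-! ### Convergence of Jacobi series. -/

namespace JacobiSeries

open Polynomial

variable {β : ℝ} (hβ : 0 < β) {g : ℝ → ℝ} (hg : ContinuousOn g (Set.Icc 0 1))

theorem jacobiOp_sum {ι : Type*} (s : Finset ι) (f : ι → ℝ[X]) :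
    jacobiOp β (∑ i ∈ s, f i) = ∑ i ∈ s, jacobiOp β (f i) := by
  simp only [jacobiOp, derivative_sum, mul_sum, sum_add_distrib]

theorem jacobiOp_smul (a : ℝ) (f : ℝ[X]) : jacobiOp β (a • f) = a • jacobiOp β f := by
  simp only [jacobiOp, derivative_smul, smul_add, mul_smul_comm]

/-- The partial sum of the Jacobi series of `g`. -/
noncomputable def partialSum (N : ℕ) : ℝ[X] :=
  ∑ k ∈ range N, ((β + 2 * k) * pairing hβ hg (jacobiPoly β k)) • jacobiPoly β k

theorem weightInt_partialSum_mul_jacobiPoly {N l : ℕ} (hl : l < N) :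
    weightInt hβ (partialSum hβ hg N * jacobiPoly β l) = pairing hβ hg (jacobiPoly β l) := by
  rw [partialSum, Finset.sum_mul, map_sum]
  simp only [smul_mul_assoc, map_smul, weightInt_jacobiPoly_mul, smul_eq_mul, mul_ite, mul_zero]
  rw [Finset.sum_ite_eq', if_pos (by simpa using hl)]
  have : β + 2 * (l : ℝ) ≠ 0 := by positivity
  field_simp

/-- Testing `H` on the partial sum itself is self-improving: by orthogonality both the left side and
the quantity under the root are the sum `S` in question, so `S ≤ K √S` and `S ≤ K²`. -/
theorem sum_pairing_sq_le {K : ℝ}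
    (H : ∀ q : ℝ[X], |pairing hβ hg (jacobiOp β q)| ≤
      K * √(weightInt hβ (X * (1 - X) * derivative q * derivative q))) (N : ℕ) :
    ∑ k ∈ range N, (k * (k + β)) * (β + 2 * k) * pairing hβ hg (jacobiPoly β k) ^ 2 ≤ K ^ 2 := by
  set S := ∑ k ∈ range N, ((k : ℝ) * (k + β)) * (β + 2 * k) *
    pairing hβ hg (jacobiPoly β k) ^ 2 with hS
  have hS0 : 0 ≤ S := Finset.sum_nonneg fun k _ => by positivity
  have hL : jacobiOp β (partialSum hβ hg N) = -∑ k ∈ range N,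
      (((k : ℝ) * (k + β)) * ((β + 2 * k) * pairing hβ hg (jacobiPoly β k))) • jacobiPoly β k := by
    rw [partialSum, jacobiOp_sum, ← Finset.sum_neg_distrib]
    refine Finset.sum_congr rfl fun k _ => ?_
    rw [jacobiOp_smul, jacobiOp_jacobiPoly, ← smul_eq_C_mul, smul_smul, ← neg_smul]
    congr 1; ring
  have h1 : pairing hβ hg (jacobiOp β (partialSum hβ hg N)) = -S := by
    rw [hL, map_neg, map_sum, hS]
    congr 1
    refine Finset.sum_congr rfl fun k _ => ?_
    rw [map_smul, smul_eq_mul]; ring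
  have h2 : weightInt hβ (X * (1 - X) * derivative (partialSum hβ hg N) *
      derivative (partialSum hβ hg N)) = S := by
    rw [← neg_neg (weightInt hβ _), ← weightInt_jacobiOp_mul, hL, neg_mul, map_neg, neg_neg,
      Finset.sum_mul, map_sum, hS]
    refine Finset.sum_congr rfl fun k hk => ?_
    rw [smul_mul_assoc, map_smul, mul_comm (jacobiPoly β k),
      weightInt_partialSum_mul_jacobiPoly hβ hg (by simpa using hk), smul_eq_mul]
    ring
  have h3 := H (partialSum hβ hg N)
  rw [h1, h2, abs_neg, abs_of_nonneg hS0] at h3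
  rcases hS0.eq_or_lt with h | h
  · rw [← h]; positivity
  · have hs : 0 < √S := Real.sqrt_pos.2 h
    have h4 : √S ≤ K := by
      have : √S * √S ≤ K * √S := by rw [Real.mul_self_sqrt hS0]; exact h3
      exact le_of_mul_le_mul_right this hs
    calc S = √S ^ 2 := (Real.sq_sqrt hS0).symm
      _ ≤ K ^ 2 := pow_le_pow_left₀ hs.le h4 2

/-- Locally uniform, absolute convergence of the Jacobi series of a function with a weak derivative
in the weighted `L²` space. -/
theorem exists_summable_bound {K : ℝ}
    (H : ∀ q : ℝ[X], |pairing hβ hg (jacobiOp β q)| ≤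
      K * √(weightInt hβ (X * (1 - X) * derivative q * derivative q)))
    {c d : ℝ} (hc : 0 < c) (hcd : c < d) (hd : d < 1) :
    ∃ b : ℕ → ℝ, Summable b ∧ ∀ k, ∀ x ∈ Set.Icc c d,
      |(β + 2 * k) * pairing hβ hg (jacobiPoly β k) * (jacobiPoly β k).eval x| ≤ b k := by
  obtain ⟨C, hC0, hC⟩ := exists_bound_jacobiPoly hβ hc hcd hd
  set a : ℕ → ℝ := fun k => pairing hβ hg (jacobiPoly β k) with ha
  -- The bound is `2st ≤ s² + t²` with `s = k |a_k|`, `t = |p_k(x)| / k`, multiplied by `β + 2k`. At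
  -- `k = 0` both of these pieces are zero (`1 / 0 = 0`), so that term is added separately.
  refine ⟨fun k => (((k : ℝ) * (k + β)) * (β + 2 * k) * a k ^ 2 + C * (1 / (k : ℝ) ^ 2)) +
    (if k = 0 then |β * a 0| else 0), ?_, fun k x hx => ?_⟩
  · refine Summable.add (Summable.add ?_ ?_) ?_
    · exact summable_of_sum_range_le (fun k => by positivity) (sum_pairing_sq_le hβ hg H)
    · exact (Real.summable_one_div_nat_pow.2 one_lt_two).mul_left C
    · exact (hasSum_ite_eq 0 _).summable
  · rcases Nat.eq_zero_or_pos k with rfl | hk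
    · simp [jacobiPoly, ha]
    · have hk1 : (0 : ℝ) < k := by exact_mod_cast hk
      dsimp only
      rw [if_neg hk.ne', add_zero]
      set y := (jacobiPoly β k).eval x
      have hb : 0 < β + 2 * (k : ℝ) := by positivity
      have h1 := hC k x hx
      change |(β + 2 * k) * a k * y| ≤ _
      have h2 : |(β + 2 * k) * a k * y| = (β + 2 * k) * ((k * |a k|) * (|y| / k)) := by
        rw [abs_mul, abs_mul, abs_of_pos hb]; field_simp
      have h3 : (k * |a k|) * (|y| / k) ≤ k ^ 2 * a k ^ 2 + y ^ 2 / k ^ 2 := by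
        have := two_mul_le_add_sq (k * |a k|) (|y| / k)
        rw [mul_pow, div_pow, sq_abs, sq_abs] at this
        have h0 : 0 ≤ (k * |a k|) * (|y| / k) := by positivity
        linarith
      rw [h2]
      calc _ ≤ (β + 2 * k) * (k ^ 2 * a k ^ 2 + y ^ 2 / k ^ 2) :=
            mul_le_mul_of_nonneg_left h3 hb.le
        _ = k ^ 2 * ((β + 2 * k) * a k ^ 2) + ((β + 2 * k) * y ^ 2) * (1 / k ^ 2) := by ring
        _ ≤ (k * (k + β)) * ((β + 2 * k) * a k ^ 2) + C * (1 / k ^ 2) := by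
            refine add_le_add (mul_le_mul_of_nonneg_right ?_ (by positivity))
              (mul_le_mul_of_nonneg_right h1 (by positivity))
            nlinarith
        _ = _ := by ring

theorem continuousOn_sub_polynomial {g : ℝ → ℝ} (hg : ContinuousOn g (Set.Icc 0 1)) (P : ℝ[X]) :
    ContinuousOn (fun x => g x - P.eval x) (Set.Icc 0 1) := hg.sub P.continuous.continuousOn

theorem pairing_sub_polynomial (P q : ℝ[X]) :
    pairing hβ (continuousOn_sub_polynomial hg P) q = pairing hβ hg q - weightInt hβ (P * q) := by
  rw [← pairing_polynomial, pairing_apply, pairing_apply, pairing_apply,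
    ← intervalIntegral.integral_sub]
  · congr 1; ext x; ring
  · exact intervalIntegrable_mul_rpow hβ
      ((by simpa using hg : ContinuousOn g (Set.uIcc 0 1)).mul q.continuous.continuousOn)
  · exact intervalIntegrable_mul_rpow hβ (by fun_prop)

/-- The partial sum is the orthogonal projection of `g` onto the span of the first `N` Jacobi
polynomials, so by Pythagoras it is at least as close as a Weierstrass approximant lying in that
span. -/
theorem tendsto_integral_sub_partialSum_sq :
    Tendsto (fun N => ∫ x in (0 : ℝ)..1,
      (g x - (partialSum hβ hg N).eval x) ^ 2 * x ^ (β - 1)) atTop (nhds 0) := by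
  have hgu : ContinuousOn g (Set.uIcc 0 1) := by simpa using hg
  have hii : ∀ P : ℝ[X], IntervalIntegrable
      (fun x => (g x - P.eval x) ^ 2 * x ^ (β - 1)) volume 0 1 := fun P =>
    intervalIntegrable_mul_rpow hβ ((hgu.sub P.continuous.continuousOn).pow 2)
  rw [Metric.tendsto_atTop]
  intro ε hε
  obtain ⟨δ, hδ, hδε⟩ : ∃ δ : ℝ, 0 < δ ∧ δ ^ 2 / β < ε := by
    refine ⟨√(ε * β / 2), by positivity, ?_⟩
    rw [Real.sq_sqrt (by positivity)]
    field_simp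
    norm_num
  obtain ⟨P, hP⟩ := exists_polynomial_near_of_continuousOn 0 1 g hg δ hδ
  obtain ⟨N₀, hN₀⟩ := mem_span_jacobiPoly hβ P
  refine ⟨N₀, fun N hN => ?_⟩
  set S := partialSum hβ hg N with hS
  have horth : ∀ R ∈ Submodule.span ℝ (jacobiPoly β '' (range N : Set ℕ)),
      pairing hβ (continuousOn_sub_polynomial hg S) R = 0 := by
    intro R hR
    induction hR using Submodule.span_induction with
    | mem x hx =>
      obtain ⟨l, hl, rfl⟩ := hx
      rw [pairing_sub_polynomial hβ hg, weightInt_partialSum_mul_jacobiPoly hβ hg (by simpa using hl),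
        sub_self]
    | zero => simp
    | add x y _ _ hx hy => rw [map_add, hx, hy, add_zero]
    | smul a x _ hx => rw [map_smul, hx, smul_zero]
  have hPN : P ∈ Submodule.span ℝ (jacobiPoly β '' (range N : Set ℕ)) :=
    Submodule.span_mono (Set.image_mono (by exact_mod_cast Finset.range_subset_range.2 hN)) hN₀
  have hSN : S ∈ Submodule.span ℝ (jacobiPoly β '' (range N : Set ℕ)) := by
    rw [hS, partialSum]
    exact Submodule.sum_mem _ fun k hk =>
      Submodule.smul_mem _ _ (Submodule.subset_span ⟨k, by simpa using hk, rfl⟩)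
  have h0 := horth (S - P) (Submodule.sub_mem _ hSN hPN)
  rw [pairing_apply] at h0
  have hexp : ∫ x in (0 : ℝ)..1, (g x - P.eval x) ^ 2 * x ^ (β - 1) =
      (∫ x in (0 : ℝ)..1, (g x - S.eval x) ^ 2 * x ^ (β - 1)) +
      ∫ x in (0 : ℝ)..1, (S.eval x - P.eval x) ^ 2 * x ^ (β - 1) := by
    have hi1 := hii S
    have hi2 : IntervalIntegrable (fun x => (S.eval x - P.eval x) ^ 2 * x ^ (β - 1)) volume 0 1 :=
      intervalIntegrable_mul_rpow hβ (by fun_prop)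
    have hi3 : IntervalIntegrable
        (fun x => (g x - S.eval x) * (S - P).eval x * x ^ (β - 1)) volume 0 1 :=
      intervalIntegrable_mul_rpow hβ ((hgu.sub S.continuous.continuousOn).mul
        (S - P).continuous.continuousOn)
    have : ∫ x in (0 : ℝ)..1, (g x - P.eval x) ^ 2 * x ^ (β - 1) =
        ∫ x in (0 : ℝ)..1, (((g x - S.eval x) ^ 2 * x ^ (β - 1) +
          (S.eval x - P.eval x) ^ 2 * x ^ (β - 1)) +
          2 * ((g x - S.eval x) * (S - P).eval x * x ^ (β - 1))) := by
      congr 1; ext x; rw [eval_sub]; ring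
    rw [this, intervalIntegral.integral_add (hi1.add hi2) (hi3.const_mul 2),
      intervalIntegral.integral_const_mul, h0, intervalIntegral.integral_add hi1 hi2]
    ring
  have hnn : ∀ h : ℝ → ℝ, 0 ≤ ∫ x in (0 : ℝ)..1, h x ^ 2 * x ^ (β - 1) := fun h =>
    intervalIntegral.integral_nonneg zero_le_one fun x hx =>
      mul_nonneg (sq_nonneg _) (Real.rpow_nonneg hx.1 _)
  have hbound : ∫ x in (0 : ℝ)..1, (g x - P.eval x) ^ 2 * x ^ (β - 1) ≤ δ ^ 2 / β := by
    have : ∫ x in (0 : ℝ)..1, δ ^ 2 * x ^ (β - 1) = δ ^ 2 / β := by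
      rw [intervalIntegral.integral_const_mul, integral_rpow (Or.inl (by linarith))]
      simp [Real.zero_rpow hβ.ne']; ring
    rw [← this]
    refine intervalIntegral.integral_mono_on zero_le_one (hii P)
      (intervalIntegrable_mul_rpow hβ continuousOn_const) fun x hx => ?_
    refine mul_le_mul_of_nonneg_right ?_ (Real.rpow_nonneg hx.1 _)
    rw [← sq_abs, abs_sub_comm]
    exact pow_le_pow_left₀ (abs_nonneg _) (hP x hx).le 2
  rw [Real.dist_eq, sub_zero, abs_of_nonneg (hnn fun x => g x - S.eval x)]
  have := hnn fun x => S.eval x - P.eval x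
  linarith

/-- The Jacobi series of a continuous function with a weak derivative in the weighted `L²` space
converges to it on `(0, 1)`. -/
theorem hasSum_jacobiSeries {K : ℝ}
    (H : ∀ q : ℝ[X], |pairing hβ hg (jacobiOp β q)| ≤
      K * √(weightInt hβ (X * (1 - X) * derivative q * derivative q)))
    {x : ℝ} (hx0 : 0 < x) (hx1 : x < 1) :
    HasSum (fun k : ℕ => (β + 2 * k) * pairing hβ hg (jacobiPoly β k) * (jacobiPoly β k).eval x)
      (g x) := by
  set c := x / 2 with hc
  set d := (1 + x) / 2 with hd
  have hc0 : 0 < c := by positivity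
  have hcd : c < d := by rw [hc, hd]; linarith
  have hd1 : d < 1 := by rw [hd]; linarith
  have hcd01 : Set.Icc c d ⊆ Set.Icc 0 1 := Set.Icc_subset_Icc hc0.le hd1.le
  obtain ⟨b, hb, hle⟩ := exists_summable_bound hβ hg H hc0 hcd hd1
  set t : ℕ → ℝ → ℝ := fun k x =>
    (β + 2 * k) * pairing hβ hg (jacobiPoly β k) * (jacobiPoly β k).eval x with ht
  have hSt : ∀ N y, (partialSum hβ hg N).eval y = ∑ k ∈ range N, t k y := by
    intro N y
    simp [partialSum, ht, eval_finsetSum, mul_assoc]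
  have hunif : TendstoUniformlyOn (fun N y => ∑ k ∈ range N, t k y) (fun y => ∑' k, t k y) atTop
      (Set.Icc c d) := tendstoUniformlyOn_tsum_nat hb fun k y hy => by
        rw [Real.norm_eq_abs]; exact hle k y hy
  set s : ℝ → ℝ := fun y => ∑' k, t k y with hs
  have hscont : ContinuousOn s (Set.Icc c d) :=
    hunif.continuousOn (Eventually.of_forall fun N =>
      (continuous_finsetSum _ fun k _ =>
        (continuous_const.mul (jacobiPoly β k).continuous)).continuousOn).frequently
  have hsum : Summable fun k => t k x := by
    refine Summable.of_norm_bounded hb fun k => ?_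
    rw [Real.norm_eq_abs]
    exact hle k x ⟨by rw [hc]; linarith, by rw [hd]; linarith⟩
  -- The uniform limit `s` and `g` are both continuous. If they differed at `x`, they would differ
  -- by a fixed amount on an interval around it, and the weighted `L²` error of the partial sums
  -- would stay bounded below.
  suffices hgs : g x = s x by rw [hgs]; exact hsum.hasSum
  by_contra hne
  have hxm : x ∈ Set.Ioo c d := ⟨by rw [hc]; linarith, by rw [hd]; linarith⟩
  have hcontx : ContinuousAt (fun y => |g y - s y|) x :=
    (((hg.mono hcd01).sub hscont).abs).continuousAt (Icc_mem_nhds hxm.1 hxm.2)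
  set ε := |g x - s x| / 3 with hε
  have hε0 : 0 < ε := by
    have := abs_pos.2 (sub_ne_zero.2 hne); positivity
  have hev : ∀ᶠ y in nhds x, 2 * ε < |g y - s y| :=
    hcontx.eventually (lt_mem_nhds (by simp only; rw [hε]; linarith [abs_pos.2 (sub_ne_zero.2 hne)]))
  obtain ⟨r, hr, hball⟩ := Metric.eventually_nhds_iff.1 hev
  obtain ⟨c', d', hcx, hxd, hsub⟩ : ∃ c' d', c' < x ∧ x < d' ∧
      Set.Icc c' d' ⊆ Set.Icc c d ∩ Metric.ball x r := by
    have : Set.Icc c d ∩ Metric.ball x r ∈ nhds x :=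
      Filter.inter_mem (Icc_mem_nhds hxm.1 hxm.2) (Metric.ball_mem_nhds x hr)
    obtain ⟨ρ, hρ, h⟩ := Metric.nhds_basis_closedBall.mem_iff.1 this
    exact ⟨x - ρ, x + ρ, by linarith, by linarith, by rwa [← Real.closedBall_eq_Icc]⟩
  have hcd' : c' < d' := hcx.trans hxd
  have hc'0 : 0 < c' := hc0.trans_le (hsub ⟨le_rfl, hcd'.le⟩).1.1
  have hd'1 : d' ≤ 1 := (hsub ⟨hcd'.le, le_rfl⟩).1.2.trans hd1.le
  set W := ∫ y in c'..d', y ^ (β - 1)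
  have hWint : IntervalIntegrable (fun x : ℝ => x ^ (β - 1)) volume c' d' :=
    intervalIntegral.intervalIntegrable_rpow' (by linarith)
  have hWpos : 0 < W :=
    intervalIntegral.intervalIntegral_pos_of_pos_on hWint
      (fun x hx => Real.rpow_pos_of_pos (hc'0.trans hx.1) _) hcd'
  have hlow : ∀ᶠ N in atTop, ε ^ 2 * W ≤ ∫ y in (0 : ℝ)..1,
      (g y - (partialSum hβ hg N).eval y) ^ 2 * y ^ (β - 1) := by
    filter_upwards [Metric.tendstoUniformlyOn_iff.1 hunif ε hε0] with N hN
    have hint : IntervalIntegrable (fun y => (g y - (partialSum hβ hg N).eval y) ^ 2 *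
        y ^ (β - 1)) volume 0 1 := intervalIntegrable_mul_rpow hβ
      (((by simpa using hg : ContinuousOn g (Set.uIcc 0 1)).sub
        (partialSum hβ hg N).continuous.continuousOn).pow 2)
    calc ε ^ 2 * W = ∫ y in c'..d', ε ^ 2 * y ^ (β - 1) :=
          (intervalIntegral.integral_const_mul _ _).symm
      _ ≤ ∫ y in c'..d', (g y - (partialSum hβ hg N).eval y) ^ 2 * y ^ (β - 1) := by
          refine intervalIntegral.integral_mono_on hcd'.le (hWint.const_mul _)
            (hint.mono_set ?_) fun y hy => ?_
          · rw [Set.uIcc_of_le hcd'.le, Set.uIcc_of_le zero_le_one]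
            exact Set.Icc_subset_Icc hc'0.le hd'1
          · refine mul_le_mul_of_nonneg_right ?_ (Real.rpow_nonneg (hc'0.le.trans hy.1) _)
            have h1 := hN y (hsub hy).1
            have h2 := hball (hsub hy).2
            rw [Real.dist_eq, ← hSt] at h1
            rw [← sq_abs (g y - _)]
            refine pow_le_pow_left₀ hε0.le ?_ 2
            have h3 := abs_sub_le (g y) ((partialSum hβ hg N).eval y) (s y)
            rw [abs_sub_comm ((partialSum hβ hg N).eval y) (s y)] at h3
            linarith
      _ ≤ _ := by
          refine intervalIntegral.integral_mono_interval hc'0.le hcd'.le hd'1 ?_ hint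
          refine (ae_restrict_iff' measurableSet_Ioc).2 (Eventually.of_forall fun t ht => ?_)
          exact mul_nonneg (sq_nonneg _) (Real.rpow_nonneg ht.1.le _)
  have := ge_of_tendsto (tendsto_integral_sub_partialSum_sq hβ hg) hlow
  have : 0 < ε ^ 2 * W := by positivity
  linarith

end JacobiSeries

/-! ### Gamma and beta integrals, and the change-of-variables estimate. -/

namespace GammaAngle

open scoped ENNReal

theorem lintegral_pi_prod {m : ℕ} (μ : Measure ℝ) [IsProbabilityMeasure μ] {f : ℝ → ℝ≥0∞}
    (hf : Measurable f) :
    ∫⁻ z, ∏ j : Fin m, f (z j) ∂Measure.pi (fun _ : Fin m => μ) = (∫⁻ t, f t ∂μ) ^ m := by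
  have hind : iIndepFun (fun (j : Fin m) (z : Fin m → ℝ) => f (z j))
      (Measure.pi (fun _ : Fin m => μ)) :=
    iIndepFun_pi (X := fun _ => f) fun _ => hf.aemeasurable
  rw [lintegral_prod_eq_prod_lintegral_of_indepFun Finset.univ _ hind fun j =>
    hf.comp (measurable_pi_apply j)]
  have h : ∀ j : Fin m, ∫⁻ z, f (z j) ∂Measure.pi (fun _ : Fin m => μ) = ∫⁻ t, f t ∂μ := fun j =>
    (measurePreserving_eval (fun _ : Fin m => μ) j).lintegral_comp hf
  simp [h]

theorem lintegral_rpow_mul_exp_ne_top {s r : ℝ} (hs : 0 < s) (hr : 0 < r) :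
    ∫⁻ x in Set.Ioi (0 : ℝ), ENNReal.ofReal (x ^ (s - 1) * Real.exp (-(r * x))) ≠ ∞ := by
  have h := integrableOn_rpow_mul_exp_neg_mul_rpow (s := s - 1) (p := 1) (b := r) (by linarith)
    one_pos hr
  have h2 := h.lintegral_lt_top
  simp only [Real.rpow_one, neg_mul] at h2
  exact h2.ne

theorem lintegral_rpow_mul_rpow_ne_top {a b : ℝ} (ha : 0 < a) (hb : 0 < b) :
    ∫⁻ s in Set.Ioo (0 : ℝ) 1, ENNReal.ofReal (s ^ (a - 1) * (1 - s) ^ (b - 1)) ≠ ∞ := by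
  have h := lintegral_betaPDF_eq_one ha hb
  have hB := beta_pos ha hb
  rw [lintegral_betaPDF] at h
  have e : ∀ x : ℝ, ENNReal.ofReal (1 / beta a b * x ^ (a - 1) * (1 - x) ^ (b - 1)) =
      ENNReal.ofReal (1 / beta a b) * ENNReal.ofReal (x ^ (a - 1) * (1 - x) ^ (b - 1)) := by
    intro x
    rw [← ENNReal.ofReal_mul (by positivity), mul_assoc]
  simp only [e] at h
  rw [lintegral_const_mul _ (by fun_prop)] at h
  intro htop
  rw [htop, ENNReal.mul_top (by simpa using hB)] at h
  exact ENNReal.top_ne_one h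

theorem lintegral_rpow_mul_sub_rpow {a b x : ℝ} (hx : 0 < x) :
    ∫⁻ t in Set.Ioo (0 : ℝ) x, ENNReal.ofReal (t ^ (a - 1) * (x - t) ^ (b - 1)) =
      ENNReal.ofReal (x ^ (a + b - 1)) *
        ∫⁻ s in Set.Ioo (0 : ℝ) 1, ENNReal.ofReal (s ^ (a - 1) * (1 - s) ^ (b - 1)) := by
  have himg : (fun s : ℝ => x * s) '' Set.Ioo 0 1 = Set.Ioo 0 x := by
    rw [Set.image_mul_left_Ioo hx]; simp
  rw [← himg, lintegral_image_eq_lintegral_abs_deriv_mul (f' := fun _ => x) measurableSet_Ioo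
    (fun s _ => by simpa using ((hasDerivAt_id s).const_mul x).hasDerivWithinAt)
    (fun s _ t _ h => mul_left_cancel₀ hx.ne' h), ← lintegral_const_mul _ (by fun_prop)]
  refine setLIntegral_congr_fun measurableSet_Ioo fun s hs => ?_
  rw [abs_of_pos hx, ← ENNReal.ofReal_mul hx.le, ← ENNReal.ofReal_mul (by positivity),
    show x - x * s = x * (1 - s) by ring, Real.mul_rpow hx.le hs.1.le,
    Real.mul_rpow hx.le (by linarith [hs.2]), show a + b - 1 = 1 + (a - 1) + (b - 1) by ring,
    Real.rpow_add hx, Real.rpow_add hx, Real.rpow_one]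
  congr 1; ring

theorem ae_pos_gammaMeasure (α : ℝ) : ∀ᵐ t ∂gammaMeasure α 1, 0 < t := by
  rw [gammaMeasure, ae_withDensity_iff (f := gammaPDF α 1) (by
    exact (measurable_gammaPDFReal α 1).ennreal_ofReal)]
  filter_upwards [compl_mem_ae_iff.2 ((Set.finite_singleton (0 : ℝ)).measure_zero volume)] with t ht h
  by_contra hneg
  have : t < 0 := lt_of_le_of_ne (not_lt.1 hneg) ht
  exact h (gammaPDF_of_neg this)

theorem measurable_gammaPDF (α : ℝ) : Measurable (gammaPDF α 1) :=
  (measurable_gammaPDFReal α 1).ennreal_ofReal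

theorem gammaPDF_of_pos (α : ℝ) {x : ℝ} (hx : 0 < x) :
    gammaPDF α 1 x = ENNReal.ofReal (1 / Real.Gamma α * x ^ (α - 1) * Real.exp (-x)) := by
  rw [gammaPDF_of_nonneg hx.le]; simp

theorem lintegral_gammaMeasure (α : ℝ) {f : ℝ → ℝ≥0∞} (hf : Measurable f) :
    ∫⁻ t, f t ∂gammaMeasure α 1 = ∫⁻ t in Set.Ioi 0, gammaPDF α 1 t * f t := by
  rw [gammaMeasure, lintegral_withDensity_eq_lintegral_mul _ (measurable_gammaPDF α) hf,
    ← lintegral_indicator measurableSet_Ioi]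
  refine lintegral_congr_ae ?_
  filter_upwards [compl_mem_ae_iff.2 ((Set.finite_singleton (0 : ℝ)).measure_zero volume)] with t ht
  simp only [Set.indicator, Set.mem_Ioi, Pi.mul_apply]
  split_ifs with h
  · rfl
  · rw [gammaPDF_of_neg (lt_of_le_of_ne (not_lt.1 h) ht), zero_mul]

theorem lintegral_rpow_gammaMeasure_ne_top {α s : ℝ} (hs : 0 < α + s) :
    ∫⁻ t, ENNReal.ofReal (t ^ s) ∂gammaMeasure α 1 ≠ ∞ := by
  rw [lintegral_gammaMeasure α (by fun_prop)]
  have h := ENNReal.mul_ne_top (ENNReal.ofReal_ne_top (r := |1 / Real.Gamma α|))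
    (lintegral_rpow_mul_exp_ne_top hs one_pos)
  rw [← lintegral_const_mul _ (by fun_prop)] at h
  refine ne_top_of_le_ne_top h (setLIntegral_mono (by fun_prop) fun t ht => ?_)
  have ht' : (0 : ℝ) < t := ht
  rw [gammaPDF_of_pos α ht', ← ENNReal.ofReal_mul' (by positivity),
    ← ENNReal.ofReal_mul (by positivity)]
  refine ENNReal.ofReal_le_ofReal ?_
  rw [show α + s - 1 = (α - 1) + s by ring, Real.rpow_add ht', one_mul]
  have := mul_le_mul_of_nonneg_right (le_abs_self (1 / Real.Gamma α))
    (show 0 ≤ t ^ (α - 1) * t ^ s * Real.exp (-t) by positivity)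
  linarith

/-- Change of variables and the Cauchy-Schwarz inequality: a bound in terms of the `L²` norm. -/
theorem lintegral_comp_le {A : Set ℝ} (hA : MeasurableSet A) {C D : ℝ → ℝ} (hC : Measurable C)
    (hD : Measurable D) (hder : ∀ x ∈ A, HasDerivWithinAt C (-D x) A x) (hinj : Set.InjOn C A)
    (hpos : ∀ x ∈ A, 0 < D x) {φ G : ℝ → ℝ≥0∞} (hφ : Measurable φ) (hG : Measurable G) :
    ∫⁻ x in A, G x * φ (C x) ≤ (∫⁻ y, φ y ^ 2) ^ (1 / 2 : ℝ) *
      (∫⁻ x in A, G x ^ 2 * ENNReal.ofReal (1 / D x)) ^ (1 / 2 : ℝ) := by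
  -- Insert `1 = √D · √(1/D)`: the square of `φ ∘ C · √D` is the Jacobian form of `∫ φ²` over the
  -- image of `A`.
  have h1 : ∫⁻ x in A, G x * φ (C x) = ∫⁻ x in A,
      ((fun x => φ (C x) * ENNReal.ofReal (√(D x))) *
        (fun x => G x * ENNReal.ofReal (√(1 / D x)))) x := by
    refine setLIntegral_congr_fun hA fun x hx => ?_
    have := hpos x hx
    simp only [Pi.mul_apply]
    rw [mul_mul_mul_comm, ← ENNReal.ofReal_mul (Real.sqrt_nonneg _), ← Real.sqrt_mul this.le,
      mul_one_div_cancel this.ne', Real.sqrt_one, ENNReal.ofReal_one, mul_one, mul_comm]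
  rw [h1]
  refine (ENNReal.lintegral_mul_le_Lp_mul_Lq _ Real.HolderConjugate.two_two
    (by fun_prop) (by fun_prop)).trans ?_
  refine mul_le_mul' (ENNReal.rpow_le_rpow ?_ (by norm_num))
    (ENNReal.rpow_le_rpow (le_of_eq ?_) (by norm_num))
  · have h2 : ∫⁻ x in A, (φ (C x) * ENNReal.ofReal (√(D x))) ^ (2 : ℝ) =
        ∫⁻ x in A, ENNReal.ofReal |-D x| * φ (C x) ^ 2 := by
      refine setLIntegral_congr_fun hA fun x hx => ?_
      have := hpos x hx
      rw [ENNReal.rpow_two, mul_pow, ← ENNReal.ofReal_pow (Real.sqrt_nonneg _),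
        Real.sq_sqrt this.le, abs_neg, abs_of_pos this, mul_comm]
    rw [h2, ← lintegral_image_eq_lintegral_abs_deriv_mul hA hder hinj (fun y => φ y ^ 2)]
    exact setLIntegral_le_lintegral _ _
  · refine setLIntegral_congr_fun hA fun x hx => ?_
    have := hpos x hx
    rw [ENNReal.rpow_two, mul_pow, ← ENNReal.ofReal_pow (Real.sqrt_nonneg _),
      Real.sq_sqrt (by positivity)]

end GammaAngle

/-! ### The angle cosine as a function of the largest coordinate. -/

namespace GammaAngle

open scoped ENNReal

/-- The cosine of the angle between `(x, z₁, …, z_m)` and `(1, …, 1)`. -/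
noncomputable def cosCons {m : ℕ} (z : Fin m → ℝ) (x : ℝ) : ℝ :=
  (x + ∑ j, z j) / (√(m + 1) * √(x ^ 2 + ∑ j, z j ^ 2))

/-- The absolute value of the derivative of `cosCons z`, where `x` exceeds all `z j`. -/
noncomputable def cosConsDeriv {m : ℕ} (z : Fin m → ℝ) (x : ℝ) : ℝ :=
  (∑ j, z j * (x - z j)) / (√(m + 1) * √(x ^ 2 + ∑ j, z j ^ 2) ^ 3)

theorem hasDerivAt_cosCons {m : ℕ} (z : Fin m → ℝ) {x : ℝ} (hx : 0 < x) :
    HasDerivAt (cosCons z) (-cosConsDeriv z x) x := by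
  have hQ : 0 < x ^ 2 + ∑ j, z j ^ 2 :=
    add_pos_of_pos_of_nonneg (by positivity) (Finset.sum_nonneg fun j _ => sq_nonneg _)
  have hm : (√((m : ℝ) + 1)) ≠ 0 := by positivity
  have hr : 0 < √(x ^ 2 + ∑ j, z j ^ 2) := Real.sqrt_pos.2 hQ
  have h1 : HasDerivAt (fun x : ℝ => √(x ^ 2 + ∑ j, z j ^ 2))
      ((2 * x) / (2 * √(x ^ 2 + ∑ j, z j ^ 2))) x :=
    HasDerivAt.sqrt (by simpa using (hasDerivAt_pow 2 x).add_const (∑ j, z j ^ 2)) hQ.ne'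
  have h2 : HasDerivAt (cosCons z) _ x :=
    ((hasDerivAt_id x).add_const (∑ j, z j)).div (h1.const_mul (√((m : ℝ) + 1)))
      (mul_ne_zero hm hr.ne')
  refine h2.congr_deriv ?_
  have hs : √(x ^ 2 + ∑ j, z j ^ 2) ^ 2 = x ^ 2 + ∑ j, z j ^ 2 := Real.sq_sqrt hQ.le
  have hsum : ∑ j, z j * (x - z j) = x * ∑ j, z j - ∑ j, z j ^ 2 := by
    rw [Finset.mul_sum, ← Finset.sum_sub_distrib]
    exact Finset.sum_congr rfl fun j _ => by ring
  unfold cosConsDeriv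
  rw [hsum]
  set r := √(x ^ 2 + ∑ j, z j ^ 2)
  simp only [id]
  field_simp
  linear_combination hs

/-- Each `t j` is at most the sum. This trades the sum in the derivative of the cosine for a
product, so that integrals over the other coordinates factorize. -/
theorem prod_rpow_le_sum {m : ℕ} (hm : 0 < m) {t : Fin m → ℝ} (ht : ∀ j, 0 ≤ t j) :
    ∏ j, t j ^ (1 / m : ℝ) ≤ ∑ j, t j := by
  have hT : 0 ≤ ∑ j, t j := Finset.sum_nonneg fun j _ => ht j
  calc ∏ j, t j ^ (1 / m : ℝ) ≤ ∏ _j : Fin m, (∑ j, t j) ^ (1 / m : ℝ) :=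
        Finset.prod_le_prod (fun j _ => Real.rpow_nonneg (ht j) _) fun j _ =>
          Real.rpow_le_rpow (ht j) (Finset.single_le_sum (fun i _ => ht i) (Finset.mem_univ j))
            (by positivity)
    _ = ∑ j, t j := by
        have : (m : ℝ) ≠ 0 := by positivity
        simp only [Finset.prod_const, Finset.card_univ, Fintype.card_fin]
        rw [← Real.rpow_natCast, ← Real.rpow_mul hT, one_div_mul_cancel this, Real.rpow_one]

theorem one_div_cosConsDeriv_le {m : ℕ} (hm : 0 < m) {z : Fin m → ℝ} {x : ℝ} (hz : ∀ j, 0 < z j)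
    (hx : ∀ j, z j < x) :
    1 / cosConsDeriv z x ≤
      ((m : ℝ) + 1) ^ 2 * x ^ 3 * ∏ j, (z j * (x - z j)) ^ (-(1 / m : ℝ)) := by
  have hx0 : 0 < x := (hz ⟨0, hm⟩).trans (hx ⟨0, hm⟩)
  have ht : ∀ j, 0 < z j * (x - z j) := fun j => mul_pos (hz j) (sub_pos.2 (hx j))
  have hprod : 0 < ∏ j, (z j * (x - z j)) ^ (1 / m : ℝ) :=
    Finset.prod_pos fun j _ => Real.rpow_pos_of_pos (ht j) _
  have hle := prod_rpow_le_sum hm fun j => (ht j).le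
  have hinv : ∏ j, (z j * (x - z j)) ^ (-(1 / m : ℝ)) =
      (∏ j, (z j * (x - z j)) ^ (1 / m : ℝ))⁻¹ := by
    rw [← Finset.prod_inv_distrib]
    exact Finset.prod_congr rfl fun j _ => Real.rpow_neg (ht j).le _
  have hQ : x ^ 2 + ∑ j, z j ^ 2 ≤ ((m : ℝ) + 1) * x ^ 2 := by
    have : ∑ j, z j ^ 2 ≤ ∑ _j : Fin m, x ^ 2 :=
      Finset.sum_le_sum fun j _ => pow_le_pow_left₀ (hz j).le (hx j).le 2
    simp at this
    linarith
  have hr : √(x ^ 2 + ∑ j, z j ^ 2) ≤ √((m : ℝ) + 1) * x := by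
    rw [← Real.sqrt_sq hx0.le, ← Real.sqrt_mul (by positivity), Real.sq_sqrt (by positivity)]
    exact Real.sqrt_le_sqrt hQ
  have hden : √((m : ℝ) + 1) * √(x ^ 2 + ∑ j, z j ^ 2) ^ 3 ≤ ((m : ℝ) + 1) ^ 2 * x ^ 3 := by
    calc _ ≤ √((m : ℝ) + 1) * (√((m : ℝ) + 1) * x) ^ 3 :=
          mul_le_mul_of_nonneg_left (pow_le_pow_left₀ (Real.sqrt_nonneg _) hr 3) (Real.sqrt_nonneg _)
      _ = (√((m : ℝ) + 1) ^ 2) ^ 2 * x ^ 3 := by ring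
      _ = _ := by rw [Real.sq_sqrt (by positivity)]
  rw [cosConsDeriv, one_div_div, hinv, ← div_eq_mul_inv]
  exact div_le_div₀ (by positivity) hden hprod hle

/-- The kernel bounding the reciprocal derivative of the angle cosine in one coordinate. -/
noncomputable def betaKernel (m : ℕ) (x t : ℝ) : ℝ≥0∞ :=
  if 0 < t ∧ t < x then ENNReal.ofReal ((t * (x - t)) ^ (-(1 / m : ℝ))) else 0

theorem measurable_betaKernel (m : ℕ) : Measurable fun p : ℝ × ℝ => betaKernel m p.1 p.2 := by
  unfold betaKernel
  refine Measurable.ite ?_ (by fun_prop) measurable_const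
  exact (measurableSet_lt measurable_const measurable_snd).inter
    (measurableSet_lt measurable_snd measurable_fst)

/-- The square of the conditional `L²` norm of the density of the angle cosine, up to a constant. -/
noncomputable def condNormSq {m : ℕ} (α : ℝ) (z : Fin m → ℝ) : ℝ≥0∞ :=
  ∫⁻ x, gammaPDF α 1 x ^ 2 * ENNReal.ofReal (((m : ℝ) + 1) ^ 2 * x ^ 3) *
    ∏ j, betaKernel m x (z j)

theorem measurable_condNormSq_integrand {m : ℕ} (α : ℝ) :
    Measurable fun p : (Fin m → ℝ) × ℝ =>
      gammaPDF α 1 p.2 ^ 2 * ENNReal.ofReal (((m : ℝ) + 1) ^ 2 * p.2 ^ 3) *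
        ∏ j, betaKernel m p.2 (p.1 j) := by
  have h1 : Measurable fun p : (Fin m → ℝ) × ℝ => gammaPDF α 1 p.2 :=
    (measurable_gammaPDF α).comp measurable_snd
  refine ((h1.pow_const 2).mul (by fun_prop)).mul (Finset.measurable_prod _ fun j _ => ?_)
  exact (measurable_betaKernel m).comp
    (measurable_snd.prodMk ((measurable_pi_apply j).comp measurable_fst))

theorem measurable_condNormSq_integrand_right {m : ℕ} (α : ℝ) (z : Fin m → ℝ) :
    Measurable fun x : ℝ => gammaPDF α 1 x ^ 2 * ENNReal.ofReal (((m : ℝ) + 1) ^ 2 * x ^ 3) *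
      ∏ j, betaKernel m x (z j) := by
  refine (((measurable_gammaPDF α).pow_const 2).mul (by fun_prop)).mul
    (Finset.measurable_prod _ fun j _ => ?_)
  exact (measurable_betaKernel m).comp (measurable_id.prodMk measurable_const)

theorem measurable_cosCons {m : ℕ} (z : Fin m → ℝ) : Measurable (cosCons z) := by
  unfold cosCons; fun_prop

theorem measurable_cosConsDeriv {m : ℕ} (z : Fin m → ℝ) : Measurable (cosConsDeriv z) := by
  unfold cosConsDeriv; fun_prop

/-- Where `x` exceeds every `z j > 0`, the sum `∑ z j (x - z j)` is positive, so the cosine is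
strictly decreasing and can serve as a new variable; the change-of-variables estimate applies with
the gamma density as the factor `G`. -/
theorem setLIntegral_cosCons_le {m : ℕ} (hm : 0 < m) (α : ℝ) {z : Fin m → ℝ} (hz : ∀ j, 0 < z j)
    {φ : ℝ → ℝ≥0∞} (hφ : Measurable φ) :
    ∫⁻ x in {x | ∀ j, z j ≤ x}, φ (cosCons z x) ∂gammaMeasure α 1 ≤
      (∫⁻ y, φ y ^ 2) ^ (1 / 2 : ℝ) * condNormSq α z ^ (1 / 2 : ℝ) := by
  have hS : {x | ∀ j, z j ≤ x} = ⋂ j, Set.Ici (z j) := by ext; simp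
  have hA : {x | ∀ j, z j < x} = ⋂ j, Set.Ioi (z j) := by ext; simp
  have hSm : MeasurableSet {x | ∀ j, z j ≤ x} := by
    rw [hS]; exact MeasurableSet.iInter fun j => measurableSet_Ici
  have hAo : IsOpen {x | ∀ j, z j < x} := by
    rw [hA]; exact isOpen_iInter_of_finite fun j => isOpen_Ioi
  have hAc : Convex ℝ {x | ∀ j, z j < x} := by
    rw [hA]; exact convex_iInter fun j => convex_Ioi _
  have hae : ({x | ∀ j, z j ≤ x} : Set ℝ) =ᵐ[volume] {x | ∀ j, z j < x} := by
    filter_upwards [compl_mem_ae_iff.2 ((Set.finite_range z).measure_zero volume)] with x hx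
    have : (∀ j, z j ≤ x) ↔ ∀ j, z j < x :=
      forall_congr' fun j => ⟨fun h => lt_of_le_of_ne h fun e => hx ⟨j, e⟩, le_of_lt⟩
    exact propext this
  have hx0 : ∀ x ∈ {x | ∀ j, z j < x}, 0 < x := fun x hx => (hz ⟨0, hm⟩).trans (hx ⟨0, hm⟩)
  have hpos : ∀ x ∈ {x | ∀ j, z j < x}, 0 < cosConsDeriv z x := by
    intro x hx
    have h0 := hx0 x hx
    refine div_pos (Finset.sum_pos (fun j _ => mul_pos (hz j) (sub_pos.2 (hx j)))
      ⟨⟨0, hm⟩, Finset.mem_univ _⟩) ?_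
    have : 0 < x ^ 2 + ∑ j, z j ^ 2 :=
      add_pos_of_pos_of_nonneg (by positivity) (Finset.sum_nonneg fun j _ => sq_nonneg _)
    positivity
  have hder : ∀ x ∈ {x | ∀ j, z j < x}, HasDerivAt (cosCons z) (-cosConsDeriv z x) x :=
    fun x hx => hasDerivAt_cosCons z (hx0 x hx)
  have hinj : Set.InjOn (cosCons z) {x | ∀ j, z j < x} := by
    refine (strictAntiOn_of_deriv_neg hAc (fun x hx => (hder x hx).continuousAt.continuousWithinAt)
      fun x hx => ?_).injOn
    rw [hAo.interior_eq] at hx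
    rw [(hder x hx).deriv]
    exact neg_lt_zero.2 (hpos x hx)
  rw [gammaMeasure, setLIntegral_withDensity_eq_setLIntegral_mul _ (measurable_gammaPDF α)
    (show Measurable fun x => φ (cosCons z x) from hφ.comp (measurable_cosCons z)) hSm,
    setLIntegral_congr hae]
  refine (lintegral_comp_le hAo.measurableSet (measurable_cosCons z) (measurable_cosConsDeriv z)
    (fun x hx => (hder x hx).hasDerivWithinAt) hinj hpos hφ (measurable_gammaPDF α)).trans ?_
  refine mul_le_mul' le_rfl (ENNReal.rpow_le_rpow ?_ (by norm_num))
  unfold condNormSq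
  rw [← lintegral_indicator hAo.measurableSet]
  refine lintegral_mono fun x => ?_
  refine Set.indicator_apply_le' (fun hx => ?_) (fun _ => zero_le)
  rw [mul_assoc]
  refine mul_le_mul' le_rfl ?_
  have h0 := hx0 x hx
  have hk : ∀ j, betaKernel m x (z j) =
      ENNReal.ofReal ((z j * (x - z j)) ^ (-(1 / m : ℝ))) := fun j => if_pos ⟨hz j, hx j⟩
  simp only [hk]
  rw [← ENNReal.ofReal_prod_of_nonneg fun j _ =>
    Real.rpow_nonneg (mul_pos (hz j) (sub_pos.2 (hx j))).le _, ← ENNReal.ofReal_mul (by positivity)]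
  exact ENNReal.ofReal_le_ofReal (one_div_cosConsDeriv_le hm hz hx)

/-- After `e^{-t} ≤ 1` this is a beta integral on `(0, x)` with parameters `α - 1/(2m)` and `1 -
1/m`. Their positivity is where `α > 1/(2m)` and `m ≥ 2` enter. -/
theorem lintegral_betaKernel_le {m : ℕ} (hm : 2 ≤ m) {α : ℝ} (hα : 1 / (2 * m) < α) :
    ∃ K : ℝ≥0∞, K ≠ ∞ ∧ ∀ x, 0 < x →
      ∫⁻ t, ENNReal.ofReal (t ^ (1 / (2 * m) : ℝ)) * betaKernel m x t ∂gammaMeasure α 1 ≤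
        K * ENNReal.ofReal (x ^ (α - 3 / (2 * m))) := by
  have hm0 : (0 : ℝ) < m := by positivity
  have hm2 : (2 : ℝ) ≤ m := by exact_mod_cast hm
  have ha : 0 < α - 1 / (2 * m) := by linarith
  have hb : 0 < 1 - 1 / (m : ℝ) := by
    rw [sub_pos, div_lt_one hm0]; linarith
  refine ⟨ENNReal.ofReal |1 / Real.Gamma α| * ∫⁻ s in Set.Ioo (0 : ℝ) 1,
    ENNReal.ofReal (s ^ (α - 1 / (2 * m) - 1) * (1 - s) ^ (1 - 1 / (m : ℝ) - 1)),
    ENNReal.mul_ne_top ENNReal.ofReal_ne_top (lintegral_rpow_mul_rpow_ne_top ha hb),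
    fun x hx => ?_⟩
  have hmeas : Measurable fun t => betaKernel m x t :=
    (measurable_betaKernel m).comp measurable_prodMk_left
  have he : α - 3 / (2 * m) = (α - 1 / (2 * m)) + (1 - 1 / (m : ℝ)) - 1 := by field_simp; ring
  rw [lintegral_gammaMeasure α (by fun_prop), he, mul_assoc, mul_comm (lintegral _ _),
    ← lintegral_rpow_mul_sub_rpow hx, ← lintegral_const_mul _ (by fun_prop),
    ← lintegral_indicator measurableSet_Ioi, ← lintegral_indicator measurableSet_Ioo]
  refine lintegral_mono fun t => ?_
  by_cases ht : 0 < t ∧ t < x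
  · rw [Set.indicator_of_mem (show t ∈ Set.Ioi 0 from ht.1),
      Set.indicator_of_mem (show t ∈ Set.Ioo 0 x from ht), gammaPDF_of_pos α ht.1, betaKernel,
      if_pos ht, ← ENNReal.ofReal_mul (Real.rpow_nonneg ht.1.le _),
      ← ENNReal.ofReal_mul (abs_nonneg _), ← ENNReal.ofReal_mul' (by
        have := ht.1; have := sub_pos.2 ht.2; positivity)]
    refine ENNReal.ofReal_le_ofReal ?_
    have h1 := ht.1
    have h2 := sub_pos.2 ht.2
    rw [Real.mul_rpow h1.le h2.le]
    have e1 : t ^ (α - 1 / (2 * m) - 1) = t ^ (α - 1) * t ^ (1 / (2 * m) : ℝ) * t ^ (-(1 / m : ℝ)) := by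
      rw [← Real.rpow_add h1, ← Real.rpow_add h1]; congr 1; field_simp; ring
    have e2 : 1 - 1 / (m : ℝ) - 1 = -(1 / m) := by ring
    rw [e1, e2]
    have h3 : Real.exp (-t) ≤ 1 := Real.exp_le_one_iff.2 (by linarith)
    set B := t ^ (α - 1) * t ^ (1 / (2 * m) : ℝ) * t ^ (-(1 / m : ℝ)) * (x - t) ^ (-(1 / m : ℝ))
    have hB : 0 ≤ B := by positivity
    calc _ = 1 / Real.Gamma α * (Real.exp (-t) * B) := by ring
      _ ≤ |1 / Real.Gamma α| * (1 * B) :=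
          mul_le_mul (le_abs_self _) (mul_le_mul_of_nonneg_right h3 hB) (by positivity)
            (abs_nonneg _)
      _ = _ := by ring
  · have : (Set.Ioi (0 : ℝ)).indicator (fun t => gammaPDF α 1 t *
        (ENNReal.ofReal (t ^ (1 / (2 * m) : ℝ)) * betaKernel m x t)) t = 0 := by
      simp only [Set.indicator, betaKernel, if_neg ht, mul_zero, ite_self]
    rw [this]; exact zero_le

/-- Tonelli: for fixed `x` the integrand is a product over the independent coordinates `z j`. -/
theorem lintegral_prod_rpow_mul_condNormSq {m : ℕ} {α : ℝ} (hα : 0 < α) (e : ℝ) :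
    ∫⁻ z, (∏ j, ENNReal.ofReal (z j ^ e)) * condNormSq α z
        ∂Measure.pi (fun _ : Fin m => gammaMeasure α 1) =
      ∫⁻ x, gammaPDF α 1 x ^ 2 * ENNReal.ofReal (((m : ℝ) + 1) ^ 2 * x ^ 3) *
        (∫⁻ t, ENNReal.ofReal (t ^ e) * betaKernel m x t ∂gammaMeasure α 1) ^ m := by
  have := isProbabilityMeasure_gammaMeasure hα one_pos
  obtain ⟨F, hF⟩ : ∃ F : (Fin m → ℝ) → ℝ → ℝ≥0∞, F = fun z x =>
    (∏ j, ENNReal.ofReal (z j ^ e)) * (gammaPDF α 1 x ^ 2 *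
      ENNReal.ofReal (((m : ℝ) + 1) ^ 2 * x ^ 3) * ∏ j, betaKernel m x (z j)) := ⟨_, rfl⟩
  have hp' : Measurable fun z : Fin m → ℝ => ∏ j : Fin m, ENNReal.ofReal (z j ^ e) :=
    Finset.measurable_prod _ fun j _ => by fun_prop
  have hmeas : Measurable (Function.uncurry F) := by
    rw [hF]
    exact (hp'.comp measurable_fst).mul (measurable_condNormSq_integrand (m := m) α)
  have h1 : ∀ z : Fin m → ℝ, (∏ j, ENNReal.ofReal (z j ^ e)) * condNormSq α z =
      ∫⁻ x, F z x := fun z => by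
    rw [condNormSq, hF, ← lintegral_const_mul _ (measurable_condNormSq_integrand_right α z)]
  rw [lintegral_congr h1, lintegral_lintegral_swap (f := F) hmeas.aemeasurable]
  refine lintegral_congr fun x => ?_
  have hk : Measurable fun t => ENNReal.ofReal (t ^ e) * betaKernel m x t :=
    Measurable.mul (by fun_prop) ((measurable_betaKernel m).comp measurable_prodMk_left)
  rw [← lintegral_pi_prod (gammaMeasure α 1) hk, ← lintegral_const_mul]
  · refine lintegral_congr fun z => ?_
    rw [hF, Finset.prod_mul_distrib]
    exact mul_left_comm _ _ _
  · exact Finset.measurable_prod _ fun j _ => hk.comp (measurable_pi_apply j)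

theorem lintegral_prod_rpow_mul_condNormSq_ne_top {m : ℕ} (hm : 2 ≤ m) {α : ℝ}
    (hα : 1 / (2 * m) < α) :
    ∫⁻ z, (∏ j, ENNReal.ofReal (z j ^ (1 / (2 * m) : ℝ))) * condNormSq α z
        ∂Measure.pi (fun _ : Fin m => gammaMeasure α 1) ≠ ∞ := by
  have hm0 : (0 : ℝ) < m := by positivity
  have hα0 : 0 < α := lt_trans (by positivity) hα
  obtain ⟨K, hK, hle⟩ := lintegral_betaKernel_le hm hα
  rw [lintegral_prod_rpow_mul_condNormSq hα0]
  -- Power count at fixed `x`: `2(α - 1)` from the squared density, `3` from the derivative bound,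
  -- and `m` beta factors of exponent `α - 3/(2m)`; the total is `s - 1`.
  set s : ℝ := 2 * α + 2 + m * (α - 3 / (2 * m)) with hs
  have hs0 : 0 < s := by
    have : s = 2 * α + m * α + 1 / 2 := by rw [hs]; field_simp; ring
    rw [this]; positivity
  have hfin := ENNReal.mul_ne_top (ENNReal.mul_ne_top (ENNReal.pow_ne_top (n := m) hK)
    (ENNReal.ofReal_ne_top (r := (1 / Real.Gamma α) ^ 2 * ((m : ℝ) + 1) ^ 2)))
    (lintegral_rpow_mul_exp_ne_top hs0 two_pos)
  refine ne_top_of_le_ne_top hfin ?_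
  rw [← lintegral_const_mul _ (by fun_prop), ← lintegral_indicator measurableSet_Ioi]
  refine lintegral_mono fun x => ?_
  by_cases hx : 0 < x
  · rw [Set.indicator_of_mem (show x ∈ Set.Ioi 0 from hx)]
    refine (mul_le_mul' le_rfl (pow_le_pow_left' (hle x hx) m)).trans (le_of_eq ?_)
    rw [gammaPDF_of_pos α hx, mul_pow, ← ENNReal.ofReal_pow (by
      have := Real.Gamma_pos_of_pos hα0; positivity), ← ENNReal.ofReal_pow (by positivity)]
    rw [show ∀ a b c d : ℝ≥0∞, a * b * (c * d) = c * (a * b * d) by intros; ring,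
      mul_assoc (K ^ m)]
    congr 1
    rw [← ENNReal.ofReal_mul (by positivity), ← ENNReal.ofReal_mul (by positivity),
      ← ENNReal.ofReal_mul (by positivity)]
    congr 1
    have e1 : x ^ (s - 1) = x ^ (α - 1) * x ^ (α - 1) * x ^ 3 * (x ^ (α - 3 / (2 * m))) ^ m := by
      rw [← Real.rpow_natCast x 3, ← Real.rpow_natCast _ m, ← Real.rpow_mul hx.le,
        ← Real.rpow_add hx, ← Real.rpow_add hx, ← Real.rpow_add hx]
      congr 1; rw [hs]; push_cast; ring
    have e2 : Real.exp (-(2 * x)) = Real.exp (-x) * Real.exp (-x) := by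
      rw [← Real.exp_add]; congr 1; ring
    rw [e1, e2]; ring
  · have : ENNReal.ofReal (((m : ℝ) + 1) ^ 2 * x ^ 3) = 0 := by
      refine ENNReal.ofReal_eq_zero.2 (mul_nonpos_of_nonneg_of_nonpos (by positivity) ?_)
      have := not_lt.1 hx
      exact Odd.pow_nonpos (by decide) this
    rw [this]; simp

/-- Cauchy-Schwarz with the weights `∏ z_j ^ (∓e)`, `e = 1/(2m)`. This splits the singularity of
order `1/m` at `z_j = 0` evenly between the two factors: each then requires only `α > 1/(2m)`,
whereas integrating `condNormSq` directly would involve `t ^ (α - 1 - 1/m)`. -/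
theorem lintegral_sqrt_condNormSq_ne_top {m : ℕ} (hm : 2 ≤ m) {α : ℝ} (hα : 1 / (2 * m) < α) :
    ∫⁻ z, condNormSq α z ^ (1 / 2 : ℝ) ∂Measure.pi (fun _ : Fin m => gammaMeasure α 1) ≠ ∞ := by
  have hm0 : (0 : ℝ) < m := by positivity
  have hα0 : 0 < α := lt_trans (by positivity) hα
  have := isProbabilityMeasure_gammaMeasure hα0 one_pos
  set π := Measure.pi (fun _ : Fin m => gammaMeasure α 1)
  set e : ℝ := 1 / (2 * m) with he
  have hJ : Measurable fun z : Fin m → ℝ => condNormSq α z :=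
    (measurable_condNormSq_integrand α).lintegral_prod_right'
  have hp : Measurable fun z : Fin m → ℝ => ∏ j : Fin m, ENNReal.ofReal (z j ^ (-e)) :=
    Finset.measurable_prod _ fun j _ => by fun_prop
  have hp' : Measurable fun z : Fin m → ℝ => ∏ j : Fin m, ENNReal.ofReal (z j ^ e) :=
    Finset.measurable_prod _ fun j _ => by fun_prop
  have hpos : ∀ᵐ z ∂π, ∀ j, 0 < z j := by
    rw [eventually_all]
    exact fun j => (measurePreserving_eval (fun _ : Fin m => gammaMeasure α 1)
      j).quasiMeasurePreserving.ae (ae_pos_gammaMeasure α)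
  have h1 : ∫⁻ z, condNormSq α z ^ (1 / 2 : ℝ) ∂π =
      ∫⁻ z, ((fun z : Fin m → ℝ => (∏ j, ENNReal.ofReal (z j ^ (-e))) ^ (1 / 2 : ℝ)) *
        (fun z : Fin m → ℝ => ((∏ j, ENNReal.ofReal (z j ^ e)) * condNormSq α z) ^ (1 / 2 : ℝ))) z ∂π := by
    refine lintegral_congr_ae ?_
    filter_upwards [hpos] with z hz
    have : (∏ j, ENNReal.ofReal (z j ^ (-e))) * (∏ j, ENNReal.ofReal (z j ^ e)) = 1 := by
      rw [← Finset.prod_mul_distrib]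
      refine Finset.prod_eq_one fun j _ => ?_
      rw [← ENNReal.ofReal_mul (Real.rpow_nonneg (hz j).le _), ← Real.rpow_add (hz j)]
      simp
    rw [Pi.mul_apply, ← ENNReal.mul_rpow_of_nonneg _ _ (by norm_num), ← mul_assoc, this, one_mul]
  have h2 := ENNReal.lintegral_mul_le_Lp_mul_Lq π Real.HolderConjugate.two_two
    (f := fun z : Fin m → ℝ => (∏ j, ENNReal.ofReal (z j ^ (-e))) ^ (1 / 2 : ℝ))
    (g := fun z : Fin m → ℝ => ((∏ j, ENNReal.ofReal (z j ^ e)) * condNormSq α z) ^ (1 / 2 : ℝ))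
    (hp.pow_const _).aemeasurable ((hp'.mul hJ).pow_const _).aemeasurable
  rw [h1]
  refine ne_top_of_le_ne_top ?_ h2
  have hsq : ∀ a : ℝ≥0∞, (a ^ (1 / 2 : ℝ)) ^ (2 : ℝ) = a := fun a => by
    rw [← ENNReal.rpow_mul]; norm_num
  simp only [hsq]
  refine ENNReal.mul_ne_top (ENNReal.rpow_ne_top_of_nonneg (by norm_num) ?_)
    (ENNReal.rpow_ne_top_of_nonneg (by norm_num) ?_)
  · rw [lintegral_pi_prod (gammaMeasure α 1) (f := fun t => ENNReal.ofReal (t ^ (-e)))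
      (by fun_prop)]
    exact ENNReal.pow_ne_top (lintegral_rpow_gammaMeasure_ne_top (by linarith))
  · exact lintegral_prod_rpow_mul_condNormSq_ne_top hm hα

end GammaAngle

/-! ### The `L²` bound for the law of the angle cosine, and its relation to `U`. -/

namespace GammaAngle

open scoped ENNReal
open DirichletSquareSum

/-- The cosine of the angle between `x` and `(1, …, 1)`. -/
noncomputable def cosVec {n : ℕ} (x : Fin n → ℝ) : ℝ :=
  (∑ i, x i) / (√n * √(∑ i, x i ^ 2))

theorem measurable_cosVec {n : ℕ} : Measurable (cosVec (n := n)) := by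
  unfold cosVec; fun_prop

theorem cosVec_eq_cosCons {m : ℕ} (x : Fin (m + 1) → ℝ) (i : Fin (m + 1)) :
    cosVec x = cosCons (fun j => x (i.succAbove j)) (x i) := by
  unfold cosVec cosCons
  rw [Fin.sum_univ_succAbove _ i, Fin.sum_univ_succAbove (fun j => x j ^ 2) i]
  push_cast
  rfl

theorem measurable_uncurry_cosCons {m : ℕ} :
    Measurable fun p : ℝ × (Fin m → ℝ) => cosCons p.2 p.1 := by
  unfold cosCons; fun_prop

/-- Splits the product measure at the largest coordinate `i`, applies the conditional bound for
almost every choice of the others, and integrates. -/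
theorem setLIntegral_cosVec_le {m : ℕ} (hm : 2 ≤ m) {α : ℝ} (hα : 1 / (2 * m) < α)
    (i : Fin (m + 1)) {φ : ℝ → ℝ≥0∞} (hφ : Measurable φ) :
    ∫⁻ x in {x | ∀ j, x j ≤ x i}, φ (cosVec x)
        ∂Measure.pi (fun _ : Fin (m + 1) => gammaMeasure α 1) ≤
      (∫⁻ y, φ y ^ 2) ^ (1 / 2 : ℝ) *
        ∫⁻ z, condNormSq α z ^ (1 / 2 : ℝ) ∂Measure.pi (fun _ : Fin m => gammaMeasure α 1) := by
  have hα0 : 0 < α := lt_trans (by positivity) hα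
  have := isProbabilityMeasure_gammaMeasure hα0 one_pos
  set T : Set (ℝ × (Fin m → ℝ)) := {p | ∀ j, p.2 j ≤ p.1} with hT
  have hTm : MeasurableSet T := by
    have : T = ⋂ j, {p | p.2 j ≤ p.1} := by ext; simp [hT]
    rw [this]
    exact MeasurableSet.iInter fun j =>
      measurableSet_le ((measurable_pi_apply j).comp measurable_snd) measurable_fst
  have hSm : MeasurableSet {x : Fin (m + 1) → ℝ | ∀ j, x j ≤ x i} := by
    have : {x : Fin (m + 1) → ℝ | ∀ j, x j ≤ x i} = ⋂ j, {x | x j ≤ x i} := by ext; simp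
    rw [this]
    exact MeasurableSet.iInter fun j =>
      measurableSet_le (measurable_pi_apply j) (measurable_pi_apply i)
  set Ψ : ℝ × (Fin m → ℝ) → ℝ≥0∞ := T.indicator fun p => φ (cosCons p.2 p.1) with hΨ
  have hΨm : Measurable Ψ := (hφ.comp measurable_uncurry_cosCons).indicator hTm
  have hmp := measurePreserving_piFinSuccAbove
    (fun _ : Fin (m + 1) => gammaMeasure α 1) i
  have hpos : ∀ᵐ z ∂Measure.pi (fun _ : Fin m => gammaMeasure α 1), ∀ j, 0 < z j := by
    rw [eventually_all]
    exact fun j => (measurePreserving_eval (fun _ : Fin m => gammaMeasure α 1)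
      j).quasiMeasurePreserving.ae (ae_pos_gammaMeasure α)
  calc _ = ∫⁻ x, Ψ (MeasurableEquiv.piFinSuccAbove (fun _ => ℝ) i x)
        ∂Measure.pi (fun _ : Fin (m + 1) => gammaMeasure α 1) := by
        rw [← lintegral_indicator hSm]
        refine lintegral_congr fun x => ?_
        have hiff : x ∈ {x : Fin (m + 1) → ℝ | ∀ j, x j ≤ x i} ↔
            MeasurableEquiv.piFinSuccAbove (fun _ => ℝ) i x ∈ T := by
          simp only [hT, Set.mem_ofPred_eq, Fin.forall_iff_succAbove i, le_refl, true_and]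
          rfl
        by_cases h : x ∈ {x : Fin (m + 1) → ℝ | ∀ j, x j ≤ x i}
        · rw [hΨ, Set.indicator_of_mem h, Set.indicator_of_mem (hiff.1 h), cosVec_eq_cosCons x i]
          rfl
        · rw [hΨ, Set.indicator_of_notMem h, Set.indicator_of_notMem (mt hiff.2 h)]
    _ = ∫⁻ p, Ψ p ∂(gammaMeasure α 1).prod (Measure.pi (fun _ : Fin m => gammaMeasure α 1)) :=
        hmp.lintegral_comp hΨm
    _ = ∫⁻ z, (∫⁻ x, Ψ (x, z) ∂gammaMeasure α 1)
          ∂Measure.pi (fun _ : Fin m => gammaMeasure α 1) :=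
        lintegral_prod_symm' Ψ hΨm
    _ ≤ ∫⁻ z, (∫⁻ y, φ y ^ 2) ^ (1 / 2 : ℝ) * condNormSq α z ^ (1 / 2 : ℝ)
          ∂Measure.pi (fun _ : Fin m => gammaMeasure α 1) := by
        refine lintegral_mono_ae ?_
        filter_upwards [hpos] with z hz
        refine le_trans (le_of_eq ?_) (setLIntegral_cosCons_le (by omega) α hz hφ)
        have hzm : MeasurableSet {x : ℝ | ∀ j, z j ≤ x} := measurable_prodMk_right hTm
        rw [← lintegral_indicator hzm]
        rfl
    _ = _ := by
        rw [lintegral_const_mul]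
        exact ((measurable_condNormSq_integrand α).lintegral_prod_right').pow_const _

/-- The law of the angle cosine acts boundedly on `L²`. -/
theorem exists_lintegral_cosVec_le {n : ℕ} (hn : 3 ≤ n) {α : ℝ} (hα : 1 / (2 * (n - 1)) < α) :
    ∃ K : ℝ≥0∞, K ≠ ∞ ∧ ∀ φ : ℝ → ℝ≥0∞, Measurable φ →
      ∫⁻ x, φ (cosVec x) ∂Measure.pi (fun _ : Fin n => gammaMeasure α 1) ≤
        K * (∫⁻ y, φ y ^ 2) ^ (1 / 2 : ℝ) := by
  obtain ⟨m, rfl⟩ : ∃ m, n = m + 1 := ⟨n - 1, by omega⟩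
  have hα' : 1 / (2 * m) < α := by
    push_cast at hα; simpa using hα
  refine ⟨_, ENNReal.mul_ne_top (ENNReal.natCast_ne_top (m + 1))
    (lintegral_sqrt_condNormSq_ne_top (by omega) hα'), fun φ hφ => ?_⟩
  have hcover : (⋃ i : Fin (m + 1), {x : Fin (m + 1) → ℝ | ∀ j, x j ≤ x i}) = Set.univ := by
    ext x
    simpa using Finite.exists_max x
  rw [← setLIntegral_univ, ← hcover]
  refine (lintegral_iUnion_le _ _).trans ?_
  rw [tsum_fintype]
  refine (Finset.sum_le_sum fun i _ => setLIntegral_cosVec_le (by omega) hα' i hφ).trans ?_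
  simp only [Finset.sum_const, Finset.card_univ, Fintype.card_fin, nsmul_eq_mul]
  exact le_of_eq (by ring)

variable {Ω : Type*} {n : ℕ}

theorem cos_anglePhi (X : Fin n → Ω → ℝ) (ω : Ω) :
    Real.cos (anglePhi X ω) = cosVec fun i => X i ω := by
  rw [anglePhi, InnerProductGeometry.cos_angle, cosVec, EuclideanSpace.norm_eq,
    EuclideanSpace.norm_eq, mul_comm (√_)]
  simp [PiLp.inner_apply]

theorem statU_eq {X : Fin n → Ω → ℝ} {ω : Ω} (h : ∀ i, 0 < X i ω) :
    statU X ω = √(∑ i, X i ω ^ 2) / ∑ i, X i ω := by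
  have hs : 0 ≤ ∑ i, X i ω := Finset.sum_nonneg fun i _ => (h i).le
  rw [statU]
  simp only [dirichletY, div_pow]
  rw [← Finset.sum_div, Real.sqrt_div' _ (sq_nonneg _), Real.sqrt_sq hs]

/-- For positive vectors the Euclidean norm is at most the sum of the coordinates. -/
theorem one_div_sqrt_le_cosVec (hn : 0 < n) {x : Fin n → ℝ} (h : ∀ i, 0 < x i) :
    1 / √n ≤ cosVec x := by
  have : Nonempty (Fin n) := ⟨⟨0, hn⟩⟩
  have hn' : (0 : ℝ) < n := by exact_mod_cast hn
  have hq : 0 < ∑ i, x i ^ 2 :=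
    Finset.sum_pos (fun i _ => pow_pos (h i) 2) Finset.univ_nonempty
  have hle : √(∑ i, x i ^ 2) ≤ ∑ i, x i := by
    refine Real.sqrt_le_left (Finset.sum_nonneg fun i _ => (h i).le) |>.2 ?_
    rw [sq, Finset.sum_mul]
    refine Finset.sum_le_sum fun i _ => ?_
    rw [sq]
    exact mul_le_mul_of_nonneg_left
      (Finset.single_le_sum (fun j _ => (h j).le) (Finset.mem_univ i)) (h i).le
  rw [cosVec, div_le_div_iff₀ (by positivity) (by positivity), one_mul, mul_comm]
  exact mul_le_mul_of_nonneg_right hle (by positivity)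

theorem statU_le_iff (hn : 0 < n) {X : Fin n → Ω → ℝ} {ω : Ω} (h : ∀ i, 0 < X i ω) {u : ℝ}
    (hu : 0 < u) : statU X ω ≤ u ↔ 1 / (√n * u) ≤ Real.cos (anglePhi X ω) := by
  have : Nonempty (Fin n) := ⟨⟨0, hn⟩⟩
  have hn' : (0 : ℝ) < √n := Real.sqrt_pos.2 (by exact_mod_cast hn)
  have hq : 0 < √(∑ i, X i ω ^ 2) := Real.sqrt_pos.2
    (Finset.sum_pos (fun i _ => pow_pos (h i) 2) Finset.univ_nonempty)
  have hs : 0 < ∑ i, X i ω := Finset.sum_pos (fun i _ => h i) Finset.univ_nonempty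
  rw [cos_anglePhi, statU_eq h, cosVec, div_le_iff₀ hs, div_le_div_iff₀ (by positivity)
    (by positivity), one_mul]
  constructor
  · intro H
    calc √n * √(∑ i, X i ω ^ 2) ≤ √n * (u * ∑ i, X i ω) := mul_le_mul_of_nonneg_left H hn'.le
      _ = _ := by ring
  · intro H
    have : √n * √(∑ i, X i ω ^ 2) ≤ √n * (u * ∑ i, X i ω) := H.trans (le_of_eq (by ring))
    exact le_of_mul_le_mul_left this hn'

end GammaAngle

/-! ### Tail functions of `L²`-bounded laws: continuity, weak derivative, Jacobi coefficients. -/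

namespace JacobiSeries

open Polynomial
open scoped ENNReal NNReal

/-- Integration against `μ` is bounded by `K` times the `L²` norm. -/
def L2Bounded (μ : Measure ℝ) (K : ℝ≥0) : Prop :=
  ∀ φ : ℝ → ℝ≥0∞, Measurable φ → ∫⁻ x, φ x ∂μ ≤ K * (∫⁻ y, φ y ^ 2) ^ (1 / 2 : ℝ)

theorem L2Bounded.integral_le {μ : Measure ℝ} {K : ℝ≥0} (hμ : L2Bounded μ K)
    (hsupp : ∀ᵐ x ∂μ, x ∈ Set.Icc (0 : ℝ) 1) {h v : ℝ → ℝ} (hm : Measurable h)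
    (h0 : ∀ x ∈ Set.Icc (0 : ℝ) 1, 0 ≤ h x) (hv : ∀ x ∈ Set.Icc (0 : ℝ) 1, h x ^ 2 ≤ v x)
    (hvi : IntervalIntegrable v volume 0 1) :
    ∫ x, h x ∂μ ≤ K * √(∫ x in (0 : ℝ)..1, v x) := by
  have hv0 : ∀ x ∈ Set.Icc (0 : ℝ) 1, 0 ≤ v x := fun x hx => (sq_nonneg _).trans (hv x hx)
  rw [integral_eq_lintegral_of_nonneg_ae (by filter_upwards [hsupp] with x hx using h0 x hx)
    hm.aestronglyMeasurable]
  have hφ := hμ ((Set.Icc (0 : ℝ) 1).indicator fun x => ENNReal.ofReal (h x))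
    (hm.ennreal_ofReal.indicator measurableSet_Icc)
  have e1 : ∫⁻ x, (Set.Icc (0 : ℝ) 1).indicator (fun x => ENNReal.ofReal (h x)) x ∂μ =
      ∫⁻ x, ENNReal.ofReal (h x) ∂μ := by
    refine lintegral_congr_ae ?_
    filter_upwards [hsupp] with x hx using Set.indicator_of_mem hx _
  have hvI : IntegrableOn v (Set.Icc 0 1) :=
    (intervalIntegrable_iff_integrableOn_Icc_of_le zero_le_one).1 hvi
  have e2 : ∫⁻ y, ((Set.Icc (0 : ℝ) 1).indicator (fun x => ENNReal.ofReal (h x)) y) ^ 2 ≤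
      ENNReal.ofReal (∫ x in (0 : ℝ)..1, v x) := by
    rw [intervalIntegral.integral_of_le zero_le_one, ← integral_Icc_eq_integral_Ioc,
      ofReal_integral_eq_lintegral_ofReal hvI
        ((ae_restrict_iff' measurableSet_Icc).2 (Eventually.of_forall hv0)),
      ← lintegral_indicator measurableSet_Icc]
    refine lintegral_mono fun y => ?_
    by_cases hy : y ∈ Set.Icc (0 : ℝ) 1
    · rw [Set.indicator_of_mem hy, Set.indicator_of_mem hy, ← ENNReal.ofReal_pow (h0 y hy)]
      exact ENNReal.ofReal_le_ofReal (hv y hy)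
    · rw [Set.indicator_of_notMem hy, Set.indicator_of_notMem hy]; simp
  rw [e1] at hφ
  refine ENNReal.toReal_le_of_le_ofReal (by positivity) (hφ.trans ?_)
  rw [ENNReal.ofReal_mul (by positivity), ENNReal.ofReal_coe_nnreal, Real.sqrt_eq_rpow,
    ← ENNReal.ofReal_rpow_of_nonneg (intervalIntegral.integral_nonneg zero_le_one hv0)
      (by norm_num)]
  exact mul_le_mul' le_rfl (ENNReal.rpow_le_rpow e2 (by norm_num))

theorem l2Bounded_volume : L2Bounded (volume.restrict (Set.Icc 0 1)) 1 := by
  intro φ hφ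
  have h := ENNReal.lintegral_mul_le_Lp_mul_Lq (volume.restrict (Set.Icc (0 : ℝ) 1))
    Real.HolderConjugate.two_two hφ.aemeasurable (aemeasurable_const (b := (1 : ℝ≥0∞)))
  simp at h ⊢
  exact h.trans (ENNReal.rpow_le_rpow (setLIntegral_le_lintegral _ _) (by norm_num))

/-- Fubini on `{x ≤ c}`. It replaces integrals against the tail by `ν`-integrals of primitives. -/
theorem integral_mul_measureReal_Ici {ν : Measure ℝ} [IsFiniteMeasure ν]
    (hsupp : ∀ᵐ x ∂ν, x ∈ Set.Icc (0 : ℝ) 1) {ψ : ℝ → ℝ} (hψ : IntervalIntegrable ψ volume 0 1) :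
    ∫ x in (0 : ℝ)..1, ψ x * ν.real (Set.Ici x) = ∫ c, (∫ x in (0 : ℝ)..c, ψ x) ∂ν := by
  have hψI : IntegrableOn ψ (Set.Ioc 0 1) :=
    (intervalIntegrable_iff_integrableOn_Ioc_of_le zero_le_one).1 hψ
  set F : ℝ → ℝ → ℝ := fun x c => {p : ℝ × ℝ | p.1 ≤ p.2}.indicator (fun p => ψ p.1) (x, c)
    with hF
  have hFint : Integrable (Function.uncurry F) ((volume.restrict (Set.Ioc 0 1)).prod ν) := by
    have h1 : Integrable (fun p : ℝ × ℝ => ψ p.1) ((volume.restrict (Set.Ioc 0 1)).prod ν) :=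
      hψI.comp_fst ν
    exact h1.indicator (measurableSet_le measurable_fst measurable_snd)
  have h1 : ∀ x, ∫ c, F x c ∂ν = ψ x * ν.real (Set.Ici x) := by
    intro x
    have : (fun c => F x c) = (Set.Ici x).indicator fun _ => ψ x := by
      ext c
      simp [hF, Set.indicator]
    rw [this, integral_indicator measurableSet_Ici]
    simp [mul_comm]
  rw [intervalIntegral.integral_of_le zero_le_one]
  simp only [← h1]
  rw [integral_integral_swap hFint]
  refine integral_congr_ae ?_
  filter_upwards [hsupp] with c hc
  rw [intervalIntegral.integral_of_le hc.1]
  have : (fun x => F x c) = (Set.Iic c).indicator ψ := by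
    ext x
    simp [hF, Set.indicator]
  rw [this, setIntegral_indicator measurableSet_Iic]
  congr 2
  ext x
  constructor
  · rintro ⟨⟨h1, h2⟩, h3⟩; exact ⟨h1, h3⟩
  · rintro ⟨h1, h3⟩; exact ⟨⟨h1, h3.trans hc.2⟩, h3⟩

/-- Testing the bound on the indicator of `[x, y)` shows that the tail is Hölder continuous of
exponent `1/2`. -/
theorem L2Bounded.continuous_measureReal_Ici {ν : Measure ℝ} [IsFiniteMeasure ν] {K : ℝ≥0}
    (hν : L2Bounded ν K) : Continuous fun x => ν.real (Set.Ici x) := by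
  have hIco : ∀ x y : ℝ, x ≤ y → ν.real (Set.Ici x) - ν.real (Set.Ici y) ≤ K * √(y - x) := by
    intro x y hxy
    have hd : Set.Ici x = Set.Ico x y ∪ Set.Ici y := (Set.Ico_union_Ici_eq_Ici hxy).symm
    rw [hd, measureReal_union (by
      rw [Set.disjoint_left]; intro c hc hc'; exact absurd hc.2 (not_lt.2 hc')) measurableSet_Ici,
      add_sub_cancel_right]
    have h := hν ((Set.Ico x y).indicator 1) (measurable_one.indicator measurableSet_Ico)
    have e : (fun t : ℝ => ((Set.Ico x y).indicator (1 : ℝ → ℝ≥0∞) t) ^ 2) =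
        (Set.Ico x y).indicator 1 := by
      ext t
      by_cases ht : t ∈ Set.Ico x y
      · rw [Set.indicator_of_mem ht]; simp
      · rw [Set.indicator_of_notMem ht]; simp
    rw [e, lintegral_indicator_one measurableSet_Ico, lintegral_indicator_one measurableSet_Ico,
      Real.volume_Ico, ENNReal.ofReal_rpow_of_nonneg (sub_nonneg.2 hxy) (by norm_num),
      ← Real.sqrt_eq_rpow] at h
    refine ENNReal.toReal_le_of_le_ofReal (by positivity) (h.trans (le_of_eq ?_))
    rw [ENNReal.ofReal_mul (by positivity), ENNReal.ofReal_coe_nnreal]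
  have hanti : ∀ x y : ℝ, x ≤ y → ν.real (Set.Ici y) ≤ ν.real (Set.Ici x) := fun x y h =>
    measureReal_mono (Set.Ici_subset_Ici.2 h)
  have hdist : ∀ x y : ℝ, dist (ν.real (Set.Ici x)) (ν.real (Set.Ici y)) ≤ K * √|x - y| := by
    intro x y
    rcases le_total x y with h | h
    · rw [Real.dist_eq, abs_of_nonneg (sub_nonneg.2 (hanti x y h)), abs_sub_comm,
        abs_of_nonneg (sub_nonneg.2 h)]
      exact hIco x y h
    · rw [dist_comm, Real.dist_eq, abs_of_nonneg (sub_nonneg.2 (hanti y x h)),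
        abs_of_nonneg (sub_nonneg.2 h)]
      exact hIco y x h
  rw [continuous_iff_continuousAt]
  intro y
  rw [ContinuousAt, tendsto_iff_dist_tendsto_zero]
  refine squeeze_zero (fun _ => dist_nonneg) (fun x => hdist x y) ?_
  have : Continuous fun x : ℝ => (K : ℝ) * √|x - y| := by fun_prop
  simpa using this.tendsto y

theorem weightInt_deriv_sq_apply {β : ℝ} (hβ : 0 < β) (q : ℝ[X]) :
    weightInt hβ (X * (1 - X) * derivative q * derivative q) =
      ∫ x in (0 : ℝ)..1, x ^ β * (1 - x) * (derivative q).eval x ^ 2 := by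
  rw [weightInt_apply, intervalIntegral.integral_of_le zero_le_one,
    intervalIntegral.integral_of_le zero_le_one]
  refine setIntegral_congr_fun measurableSet_Ioc fun x hx => ?_
  have : x ^ β = x * x ^ (β - 1) := by
    rw [Real.rpow_sub_one hx.1.ne']; field_simp [hx.1.ne']
  simp only [eval_mul, eval_X, eval_sub, eval_one]
  rw [this]; ring

theorem continuousOn_rpow_mul_measureReal_Ici {ν : Measure ℝ} [IsFiniteMeasure ν] {K : ℝ≥0}
    (hν : L2Bounded ν K) {τ : ℝ} (hτ : 0 ≤ τ) :
    ContinuousOn (fun x => x ^ τ * ν.real (Set.Ici x)) (Set.Icc 0 1) :=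
  ((Real.continuous_rpow_const hτ).mul hν.continuous_measureReal_Ici).continuousOn

theorem pairing_rpow_mul_measureReal_Ici {ν : Measure ℝ} [IsFiniteMeasure ν] {K : ℝ≥0}
    (hν : L2Bounded ν K) (hsupp : ∀ᵐ x ∂ν, x ∈ Set.Icc (0 : ℝ) 1) {τ β : ℝ} (hτ : 0 ≤ τ)
    (hβ : 0 < β) (p : ℝ[X]) :
    pairing hβ (continuousOn_rpow_mul_measureReal_Ici hν hτ) p =
      ∫ c, (∫ x in (0 : ℝ)..c, p.eval x * x ^ (τ + β - 1)) ∂ν := by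
  rw [← integral_mul_measureReal_Ici hsupp
    (intervalIntegrable_mul_rpow (by linarith) p.continuous.continuousOn), pairing_apply,
    intervalIntegral.integral_of_le zero_le_one, intervalIntegral.integral_of_le zero_le_one]
  refine setIntegral_congr_fun measurableSet_Ioc fun x hx => ?_
  rw [show τ + β - 1 = τ + (β - 1) by ring, Real.rpow_add hx.1]
  ring

/-- For `τ = 0` the integrand is the exact derivative of `x ^ β (1 - x) q'`. The extra power `x ^ τ`
leaves the correction proportional to `τ`. -/
theorem integral_jacobiOp_mul_rpow {τ β c : ℝ} (hs : 0 < τ + β) (hc : 0 ≤ c) (q : ℝ[X]) :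
    ∫ x in (0 : ℝ)..c, (jacobiOp β q).eval x * x ^ (τ + β - 1) =
      c ^ (τ + β) * ((1 - c) * (derivative q).eval c) -
        τ * ∫ x in (0 : ℝ)..c, (1 - x) * (derivative q).eval x * x ^ (τ + β - 1) := by
  have h := integral_deriv_polynomial_mul_rpow hs hc ((1 - X) * derivative q)
  simp only [eval_mul, eval_sub, eval_one, eval_X] at h
  rw [← h, ← intervalIntegral.integral_const_mul, ← intervalIntegral.integral_sub]
  · congr 1; ext x
    simp only [jacobiOp, derivative_mul, derivative_sub, derivative_one, derivative_X, eval_mul,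
      eval_add, eval_sub, eval_X, eval_one, eval_zero, eval_C]
    ring
  · exact intervalIntegrable_mul_rpow hs (by fun_prop)
  · exact (intervalIntegrable_mul_rpow hs (by fun_prop)).const_mul _

theorem integrable_of_continuous_of_ae_mem_Icc {ν : Measure ℝ} [IsFiniteMeasure ν]
    (hsupp : ∀ᵐ x ∂ν, x ∈ Set.Icc (0 : ℝ) 1) {h : ℝ → ℝ} (hh : Continuous h) :
    Integrable h ν := by
  rw [← Measure.restrict_eq_self_of_ae_mem hsupp]
  exact hh.continuousOn.integrableOn_compact isCompact_Icc

/-- The tail function of an `L²`-bounded law, times a power, has a weak derivative in the weighted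
`L²` space. -/
theorem abs_pairing_jacobiOp_le {ν : Measure ℝ} [IsProbabilityMeasure ν] {K : ℝ≥0}
    (hν : L2Bounded ν K) (hsupp : ∀ᵐ x ∂ν, x ∈ Set.Icc (0 : ℝ) 1) {τ β : ℝ} (hτ : 0 ≤ τ)
    (hβ : 0 < β) (h : τ = 0 ∨ 2 ≤ 2 * τ + β) (q : ℝ[X]) :
    |pairing hβ (continuousOn_rpow_mul_measureReal_Ici hν hτ) (jacobiOp β q)| ≤
      (K + τ) * √(weightInt hβ (X * (1 - X) * derivative q * derivative q)) := by
  have hs : 0 < τ + β := by linarith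
  rw [weightInt_deriv_sq_apply, pairing_rpow_mul_measureReal_Ici hν hsupp hτ]
  set I := ∫ x in (0 : ℝ)..1, x ^ β * (1 - x) * (derivative q).eval x ^ 2
  have hIi : IntervalIntegrable (fun x => x ^ β * (1 - x) * (derivative q).eval x ^ 2)
      volume 0 1 := by
    refine Continuous.intervalIntegrable ?_ _ _
    exact ((Real.continuous_rpow_const hβ.le).mul (by fun_prop)).mul
      ((derivative q).continuous.pow 2)
  set h1 : ℝ → ℝ := fun c => c ^ (τ + β) * (|1 - c| * |(derivative q).eval c|) with hh1
  have hc1 : Continuous h1 := (Real.continuous_rpow_const hs.le).mul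
    ((by fun_prop : Continuous fun c : ℝ => |1 - c|).mul (derivative q).continuous.abs)
  set h2 : ℝ → ℝ := fun x => |1 - x| * |(derivative q).eval x| * x ^ (τ + β - 1) with hh2
  have hi2 : IntervalIntegrable h2 volume 0 1 :=
    intervalIntegrable_mul_rpow hs ((by fun_prop : Continuous fun c : ℝ => |1 - c|).mul
      (derivative q).continuous.abs).continuousOn
  -- The boundary term at `c`, integrated against `ν`: this is where the `L²` bound on the law is
  -- used.
  have b1 : ∫ c, h1 c ∂ν ≤ K * √I := by
    refine hν.integral_le hsupp hc1.measurable (fun x hx => ?_) (fun x hx => ?_) hIi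
    · have := Real.rpow_nonneg hx.1 (τ + β)
      positivity
    · have hx1 : 0 ≤ 1 - x := sub_nonneg.2 hx.2
      have hle : x ^ (τ + β) ≤ 1 := Real.rpow_le_one hx.1 hx.2 hs.le
      have hle2 : x ^ (τ + β) ≤ x ^ β := by
        rcases hx.1.eq_or_lt with h0 | h0
        · rw [← h0, Real.zero_rpow hs.ne', Real.zero_rpow hβ.ne']
        · exact Real.rpow_le_rpow_of_exponent_ge h0 hx.2 (by linarith)
      have hnn := Real.rpow_nonneg hx.1 (τ + β)
      have e1 : x ^ (τ + β) * x ^ (τ + β) ≤ x ^ β :=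
        (mul_le_of_le_one_right hnn hle).trans hle2
      have e2 : (1 - x) ^ 2 ≤ 1 - x := by nlinarith [hx.1]
      calc h1 x ^ 2 = (x ^ (τ + β) * x ^ (τ + β)) * ((1 - x) ^ 2) * (derivative q).eval x ^ 2 := by
            rw [hh1]; simp only [mul_pow, sq_abs]; ring
        _ ≤ x ^ β * (1 - x) * (derivative q).eval x ^ 2 :=
            mul_le_mul_of_nonneg_right (mul_le_mul e1 e2 (sq_nonneg _)
              (Real.rpow_nonneg hx.1 _)) (sq_nonneg _)
  -- The correction term needs only Cauchy-Schwarz for Lebesgue measure on `[0, 1]`. The comparison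
  -- `x ^ (2 (τ + β - 1)) ≤ x ^ β` there is what requires `2 ≤ 2τ + β`.
  have b2 : τ * ∫ x in (0 : ℝ)..1, h2 x ≤ τ * √I := by
    rcases h with rfl | h
    · simp
    refine mul_le_mul_of_nonneg_left ?_ hτ
    have := l2Bounded_volume.integral_le (h := h2)
      (v := fun x => x ^ β * (1 - x) * (derivative q).eval x ^ 2)
      (ae_restrict_mem measurableSet_Icc) (by fun_prop) (fun x hx => ?_) (fun x hx => ?_) hIi
    · rwa [NNReal.coe_one, one_mul, integral_Icc_eq_integral_Ioc,
        ← intervalIntegral.integral_of_le zero_le_one] at this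
    · have := Real.rpow_nonneg hx.1 (τ + β - 1)
      positivity
    · have hx1 : 0 ≤ 1 - x := sub_nonneg.2 hx.2
      have e1 : x ^ (τ + β - 1) * x ^ (τ + β - 1) ≤ x ^ β := by
        rcases hx.1.eq_or_lt with h0 | h0
        · rw [← h0, Real.zero_rpow hβ.ne']
          have : τ + β - 1 ≠ 0 := by
            intro h; linarith
          rw [Real.zero_rpow this]; simp
        · rw [← Real.rpow_add h0]
          exact Real.rpow_le_rpow_of_exponent_ge h0 hx.2 (by linarith)
      have e2 : (1 - x) ^ 2 ≤ 1 - x := by nlinarith [hx.1]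
      calc h2 x ^ 2 = (x ^ (τ + β - 1) * x ^ (τ + β - 1)) * ((1 - x) ^ 2) *
            (derivative q).eval x ^ 2 := by
            rw [hh2]; simp only [mul_pow, sq_abs]; ring
        _ ≤ x ^ β * (1 - x) * (derivative q).eval x ^ 2 :=
            mul_le_mul_of_nonneg_right (mul_le_mul e1 e2 (sq_nonneg _)
              (Real.rpow_nonneg hx.1 _)) (sq_nonneg _)
  have hpt : ∀ c ∈ Set.Icc (0 : ℝ) 1,
      |∫ x in (0 : ℝ)..c, (jacobiOp β q).eval x * x ^ (τ + β - 1)| ≤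
        h1 c + τ * ∫ x in (0 : ℝ)..1, h2 x := by
    intro c hc
    rw [integral_jacobiOp_mul_rpow hs hc.1]
    refine (abs_sub _ _).trans (add_le_add (le_of_eq ?_) ?_)
    · rw [abs_mul, abs_mul, abs_of_nonneg (Real.rpow_nonneg hc.1 _)]
    · rw [abs_mul, abs_of_nonneg hτ]
      refine mul_le_mul_of_nonneg_left ?_ hτ
      refine (intervalIntegral.abs_integral_le_integral_abs hc.1).trans ?_
      have : ∫ x in (0 : ℝ)..c, |(1 - x) * (derivative q).eval x * x ^ (τ + β - 1)| =
          ∫ x in (0 : ℝ)..c, h2 x := by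
        rw [intervalIntegral.integral_of_le hc.1, intervalIntegral.integral_of_le hc.1]
        refine setIntegral_congr_fun measurableSet_Ioc fun x hx => ?_
        simp only [hh2]
        rw [abs_mul, abs_mul, abs_of_nonneg (Real.rpow_nonneg hx.1.le _)]
      rw [this]
      refine intervalIntegral.integral_mono_interval le_rfl hc.1 hc.2 ?_ hi2
      refine (ae_restrict_iff' measurableSet_Ioc).2 (Eventually.of_forall fun t ht => ?_)
      have := Real.rpow_nonneg ht.1.le (τ + β - 1)
      simp only [hh2, Pi.zero_apply]
      positivity
  have hint1 : Integrable h1 ν := integrable_of_continuous_of_ae_mem_Icc hsupp hc1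
  calc _ ≤ ∫ c, (h1 c + τ * ∫ x in (0 : ℝ)..1, h2 x) ∂ν := by
        rw [← Real.norm_eq_abs]
        refine norm_integral_le_of_norm_le (hint1.add (integrable_const _)) ?_
        filter_upwards [hsupp] with c hc using hpt c hc
    _ = ∫ c, h1 c ∂ν + τ * ∫ x in (0 : ℝ)..1, h2 x := by
        rw [integral_add hint1 (integrable_const _)]; simp
    _ ≤ (K + τ) * √I := by linarith

/-- The Jacobi coefficients of the tail function in terms of the moments of the law. -/
theorem pairing_jacobiPoly_eq_sum_moments {ν : Measure ℝ} [IsProbabilityMeasure ν] {K : ℝ≥0}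
    (hν : L2Bounded ν K) (hsupp : ∀ᵐ x ∂ν, x ∈ Set.Icc (0 : ℝ) 1) {τ β : ℝ} (hτ : 0 ≤ τ)
    (hβ : 0 < β) (k : ℕ) :
    pairing hβ (continuousOn_rpow_mul_measureReal_Ici hν hτ) (jacobiPoly β k) =
      ∑ j ∈ range (k + 1), (jacobiPoly β k).coeff j *
        ((∫ c, c ^ (τ + β + j) ∂ν) / (τ + β + j)) := by
  have hmono : ∀ j : ℕ, pairing hβ (continuousOn_rpow_mul_measureReal_Ici hν hτ) (X ^ j) =
      (∫ c, c ^ (τ + β + j) ∂ν) / (τ + β + j) := by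
    intro j
    rw [pairing_rpow_mul_measureReal_Ici hν hsupp hτ, ← integral_div]
    refine integral_congr_ae ?_
    filter_upwards [hsupp] with c hc
    have hs : 0 < τ + β + j := by positivity
    have : ∫ x in (0 : ℝ)..c, (X ^ j : ℝ[X]).eval x * x ^ (τ + β - 1) =
        ∫ x in (0 : ℝ)..c, x ^ (τ + β + j - 1) := by
      rw [intervalIntegral.integral_of_le hc.1, intervalIntegral.integral_of_le hc.1]
      refine setIntegral_congr_fun measurableSet_Ioc fun x hx => ?_
      simp only [eval_pow, eval_X]
      rw [← Real.rpow_natCast, ← Real.rpow_add hx.1]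
      congr 1; ring
    rw [this, integral_rpow (Or.inl (by linarith)), sub_add_cancel, Real.zero_rpow hs.ne', sub_zero]
  rw [(jacobiPoly β k).as_sum_range_C_mul_X_pow' (n := k + 1)
    (Nat.lt_succ_of_le (natDegree_jacobiPoly_le β k)), map_sum]
  refine Finset.sum_congr rfl fun j hj => ?_
  rw [← smul_eq_C_mul, map_smul, hmono, smul_eq_mul,
    ← (jacobiPoly β k).as_sum_range_C_mul_X_pow' (n := k + 1)
    (Nat.lt_succ_of_le (natDegree_jacobiPoly_le β k))]

end JacobiSeries

/-! ### Identification with `jacobiG` and the shifted Legendre polynomials. -/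

namespace JacobiSeries

open Polynomial
open DirichletSquareSum

theorem risingFactorial_eq_eval (c : ℝ) (k : ℕ) :
    risingFactorial c k = (ascPochhammer ℝ k).eval c := by
  induction k with
  | zero => simp [risingFactorial]
  | succ k ih => rw [ascPochhammer_succ_eval, ← ih]; simp [risingFactorial, Finset.prod_range_succ]

theorem Gamma_add_natCast {c : ℝ} (hc : 0 < c) (k : ℕ) :
    Real.Gamma (c + k) = (ascPochhammer ℝ k).eval c * Real.Gamma c := by
  induction k with
  | zero => simp
  | succ k ih =>
    rw [ascPochhammer_succ_eval, Nat.cast_succ, ← add_assoc, Real.Gamma_add_one (by positivity), ih]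
    ring

/-- Reversing the summation index turns the ratios of Gamma values into rising factorials; the
remaining factor is the reciprocal of the leading coefficient of `jacobiPoly A k`. -/
theorem jacobiG_eq {A : ℝ} (hA : 0 < A) (k : ℕ) (x : ℝ) :
    jacobiG k A A x =
      (-1) ^ k * k.factorial / (ascPochhammer ℝ k).eval (A + k) * (jacobiPoly A k).eval x := by
  have hasc := ascPochhammer_pos k (A + k) (by positivity)
  have hG := Real.Gamma_pos_of_pos (show 0 < A + k by positivity)
  have h2 : Real.Gamma (A + 2 * k) = (ascPochhammer ℝ k).eval (A + k) * Real.Gamma (A + k) := by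
    rw [← Gamma_add_natCast (by positivity)]; congr 1; ring
  have hpre : Real.Gamma (A + k) / Real.Gamma (A + 2 * k) =
      1 / (ascPochhammer ℝ k).eval (A + k) := by
    rw [h2]; field_simp
  have hk : (k.factorial : ℝ) ≠ 0 := by positivity
  rw [jacobiG, hpre, jacobiPoly_eval, ← Finset.sum_range_reflect, Finset.mul_sum, Finset.mul_sum]
  refine Finset.sum_congr rfl fun j hj => ?_
  have hj' : j ≤ k := by simpa [Nat.lt_succ_iff] using hj
  rw [show k + 1 - 1 - j = k - j by omega, Nat.choose_symm hj', Nat.sub_sub_self hj',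
    Nat.cast_sub hj']
  have e1 : A + 2 * (k : ℝ) - (k - j) = (A + j) + k := by ring
  have e2 : A + (k : ℝ) - (k - j) = A + j := by ring
  have hGj := Real.Gamma_pos_of_pos (show 0 < A + j by positivity)
  rw [e1, e2, Gamma_add_natCast (by positivity), mul_div_assoc, div_self hGj.ne', mul_one]
  have hsign : ((-1 : ℝ)) ^ (k - j) = (-1) ^ k * (-1) ^ j := by
    obtain ⟨m, rfl⟩ := Nat.exists_eq_add_of_le hj'
    rw [Nat.add_sub_cancel_left, pow_add, mul_right_comm, ← pow_add, ← two_mul, pow_mul]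
    simp
  rw [hsign]
  field_simp

theorem ringChoose_eq (r : ℝ) (k : ℕ) :
    Ring.choose r k = (ascPochhammer ℝ k).eval (r - k + 1) / k.factorial := by
  rw [Ring.choose_eq_smul, descPochhammer_smeval_eq_ascPochhammer, ascPochhammer_smeval_eq_eval,
    smul_eq_mul, inv_mul_eq_div]

theorem coeff_jacobiPoly_of_le {β : ℝ} {k j : ℕ} (hj : j ≤ k) : (jacobiPoly β k).coeff j =
    (-1) ^ j * (risingFactorial (β + j) k / ((j.factorial : ℝ) * ((k - j).factorial : ℝ))) := by
  rw [coeff_jacobiPoly, risingFactorial_eq_eval, Nat.cast_choose ℝ hj]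
  have hk : (k.factorial : ℝ) ≠ 0 := by positivity
  field_simp

/-- Both forms equal `(j + k)! / (j!² (k - j)!)` up to the sign. -/
theorem coeff_jacobiPoly_one_of_le {k j : ℕ} (hj : j ≤ k) : (jacobiPoly 1 k).coeff j =
    (-1) ^ j * (risingFactorial ((k : ℝ) - j + 1) (2 * j) /
      ((j.factorial : ℝ) * (j.factorial : ℝ))) := by
  have hnat : ∀ a b : ℕ, risingFactorial ((a : ℝ) + 1) b * a.factorial = (a + b).factorial := by
    intro a b
    rw [risingFactorial_eq_eval, ← Nat.factorial_mul_ascFactorial, Nat.cast_mul,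
      Nat.cast_ascFactorial]
    push_cast; ring
  rw [coeff_jacobiPoly_of_le hj]
  congr 1
  have h1 := hnat j k
  have h2 := hnat (k - j) (2 * j)
  rw [show k - j + 2 * j = j + k by omega, Nat.cast_sub hj] at h2
  rw [add_comm (1 : ℝ), div_eq_div_iff (by positivity) (by positivity)]
  have : (j.factorial : ℝ) ≠ 0 := by positivity
  linear_combination (j.factorial : ℝ) * h1 - (j.factorial : ℝ) * h2

theorem legendreStar_eq (k : ℕ) (x : ℝ) :
    legendreStar k x = (-1) ^ k * (jacobiPoly 1 k).eval x := by
  rw [legendreStar, jacobiPoly_eval, shiftedLegendre]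
  congr 1
  simp only [map_sum, map_mul, map_pow, aeval_X, aeval_C]
  refine Finset.sum_congr rfl fun j hj => ?_
  have h : (ascPochhammer ℝ k).eval (1 + j : ℝ) / k.factorial = ((k + j).choose k : ℝ) := by
    rw [add_comm (1 : ℝ), show ((j : ℝ) + 1) = ((j + 1 : ℕ) : ℝ) by push_cast; rfl,
      ← Nat.cast_ascFactorial, div_eq_iff (by positivity)]
    have := Nat.ascFactorial_eq_factorial_mul_choose j k
    rw [this, add_comm j k]; push_cast; ring
  rw [mul_div_assoc, h]
  simp

theorem convergesUniformlyAbsolutelyOn_of_bound {t : ℕ → ℝ → ℝ} {F : ℝ → ℝ} {s : Set ℝ}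
    {b : ℕ → ℝ} (hb : Summable b) (hle : ∀ k, ∀ u ∈ s, |t k u| ≤ b k)
    (hF : ∀ u ∈ s, HasSum (fun k => t k u) (F u)) : ConvergesUniformlyAbsolutelyOn t F s := by
  refine ⟨?_, fun u hu => ?_, ?_⟩
  · refine (tendstoUniformlyOn_tsum_nat hb fun k u hu => ?_).congr_right fun u hu => (hF u hu).tsum_eq
    rw [Real.norm_eq_abs]; exact hle k u hu
  · exact Summable.of_nonneg_of_le (fun k => abs_nonneg _) (fun k => hle k u hu) hb
  · refine tendstoUniformlyOn_tsum_nat hb fun k u hu => ?_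
    rw [Real.norm_eq_abs, abs_abs]; exact hle k u hu

end JacobiSeries

/-! ### Transfer to the probability space. -/

namespace GammaAngle

open DirichletSquareSum JacobiSeries
open scoped ENNReal NNReal

variable {Ω : Type*} [MeasurableSpace Ω] {P : Measure Ω} {n : ℕ} {α : ℝ} {X : Fin n → Ω → ℝ}

theorem ae_pos (hlaw : ∀ i, HasLaw (X i) (gammaMeasure α 1) P) : ∀ᵐ ω ∂P, ∀ i, 0 < X i ω := by
  rw [eventually_all]
  intro i
  have h := ae_pos_gammaMeasure α
  rw [← (hlaw i).map_eq] at h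
  exact ae_of_ae_map (hlaw i).aemeasurable h

theorem aemeasurable_vec (hlaw : ∀ i, HasLaw (X i) (gammaMeasure α 1) P) :
    AEMeasurable (fun ω i => X i ω) P :=
  aemeasurable_pi_lambda _ fun i => (hlaw i).aemeasurable

theorem aemeasurable_cos_anglePhi (hlaw : ∀ i, HasLaw (X i) (gammaMeasure α 1) P) :
    AEMeasurable (fun ω => Real.cos (anglePhi X ω)) P := by
  simp only [cos_anglePhi]
  exact measurable_cosVec.comp_aemeasurable (aemeasurable_vec hlaw)

theorem aemeasurable_statU (hlaw : ∀ i, HasLaw (X i) (gammaMeasure α 1) P) :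
    AEMeasurable (statU X) P := by
  have h : Measurable fun v : Fin n → ℝ => √(∑ i, (v i / ∑ j, v j) ^ 2) := by fun_prop
  exact h.comp_aemeasurable (aemeasurable_vec hlaw)

theorem exists_l2Bounded_cos_anglePhi (hn : 3 ≤ n) (hα : 1 / (2 * (n - 1)) < α)
    (hlaw : ∀ i, HasLaw (X i) (gammaMeasure α 1) P) (hindep : iIndepFun X P) :
    ∃ K : ℝ≥0, L2Bounded (P.map fun ω => Real.cos (anglePhi X ω)) K := by
  obtain ⟨K, hK, h⟩ := exists_lintegral_cosVec_le hn hα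
  refine ⟨K.toNNReal, fun φ hφ => ?_⟩
  rw [ENNReal.coe_toNNReal hK]
  have hpi : P.map (fun ω i => X i ω) = Measure.pi (fun _ : Fin n => gammaMeasure α 1) := by
    rw [hindep.map_fun_eq_pi_map fun i => (hlaw i).aemeasurable]
    congr 1; ext1 i; exact (hlaw i).map_eq
  rw [lintegral_map' hφ.aemeasurable (aemeasurable_cos_anglePhi hlaw)]
  simp only [cos_anglePhi]
  have h2 := h φ hφ
  have hm : Measurable fun x : Fin n → ℝ => φ (cosVec x) := hφ.comp measurable_cosVec
  rwa [← hpi, lintegral_map' hm.aemeasurable (aemeasurable_vec hlaw)] at h2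

theorem ae_cos_anglePhi_mem (hn : 0 < n) (hlaw : ∀ i, HasLaw (X i) (gammaMeasure α 1) P) :
    ∀ᵐ c ∂P.map fun ω => Real.cos (anglePhi X ω), c ∈ Set.Icc (0 : ℝ) 1 := by
  refine (ae_map_iff (aemeasurable_cos_anglePhi hlaw) measurableSet_Icc).2 ?_
  filter_upwards [ae_pos hlaw] with ω hω
  refine ⟨?_, Real.cos_le_one _⟩
  rw [cos_anglePhi]
  exact (by positivity : (0 : ℝ) ≤ 1 / √n).trans (one_div_sqrt_le_cosVec hn hω)

theorem cosMoment_eq (hlaw : ∀ i, HasLaw (X i) (gammaMeasure α 1) P) (s : ℝ) :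
    cosMoment P X s = ∫ c, c ^ s ∂P.map fun ω => Real.cos (anglePhi X ω) := by
  have hm : Measurable fun c : ℝ => c ^ s := by fun_prop
  rw [integral_map (aemeasurable_cos_anglePhi hlaw) hm.aestronglyMeasurable]
  rfl

theorem cdf_statU_eq [IsProbabilityMeasure P] (hn : 0 < n)
    (hlaw : ∀ i, HasLaw (X i) (gammaMeasure α 1) P) {u : ℝ} (hu : 0 < u) : cdf (P.map (statU X)) u =
      (P.map fun ω => Real.cos (anglePhi X ω)).real (Set.Ici (1 / (√n * u))) := by
  have := Measure.isProbabilityMeasure_map (μ := P) (aemeasurable_statU hlaw)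
  rw [cdf_eq_real, measureReal_def, measureReal_def,
    Measure.map_apply_of_aemeasurable (aemeasurable_statU hlaw) measurableSet_Iic,
    Measure.map_apply_of_aemeasurable (aemeasurable_cos_anglePhi hlaw) measurableSet_Ici]
  congr 1
  refine measure_congr ?_
  filter_upwards [ae_pos hlaw] with ω hω
  exact propext (statU_le_iff hn hω hu)

end GammaAngle

/-! ### Assembly of the two expansions. -/

namespace GammaAngle

open DirichletSquareSum JacobiSeries
open scoped ENNReal NNReal

variable {Ω : Type*} [MeasurableSpace Ω] {P : Measure Ω} [IsProbabilityMeasure P] {n : ℕ} {α : ℝ}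
  {X : Fin n → Ω → ℝ}

/-- The expansion of the distribution function of `statU` in Jacobi polynomials for a general
weight. -/
theorem convergesUniformlyAbsolutelyOn_cdf_statU (hn : 3 ≤ n) (hα : 1 / (2 * (n - 1)) < α)
    (hlaw : ∀ i, HasLaw (X i) (gammaMeasure α 1) P) (hindep : iIndepFun X P) {τ β a b : ℝ}
    (hτ : 0 ≤ τ) (hβ : 0 < β) (h : τ = 0 ∨ 2 ≤ 2 * τ + β) (ha : 1 / √n < a) (hab : a ≤ b)
    {t : ℕ → ℝ → ℝ} (ht : ∀ k u, t k u = (√n * u) ^ τ * ((β + 2 * k) *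
      (∑ j ∈ range (k + 1), (jacobiPoly β k).coeff j *
        (cosMoment P X (τ + β + j) / (τ + β + j))) * (jacobiPoly β k).eval (1 / (√n * u)))) :
    ConvergesUniformlyAbsolutelyOn t (fun u => cdf (P.map (statU X)) u) (Set.Icc a b) := by
  obtain ⟨K, hK⟩ := exists_l2Bounded_cos_anglePhi hn hα hlaw hindep
  have hsupp := ae_cos_anglePhi_mem (by omega) hlaw
  have hcdf := fun {u : ℝ} (hu : 0 < u) => cdf_statU_eq (by omega) hlaw hu
  have hprob := Measure.isProbabilityMeasure_map (μ := P) (aemeasurable_cos_anglePhi hlaw)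
  simp only [cosMoment_eq hlaw] at ht
  set ν := P.map fun ω => Real.cos (anglePhi X ω)
  simp only [← pairing_jacobiPoly_eq_sum_moments hK hsupp hτ hβ] at ht
  have hn0 : (0 : ℝ) < √n := Real.sqrt_pos.2 (by exact_mod_cast (by omega : 0 < n))
  have ha0 : 0 < a := (by positivity : (0 : ℝ) < 1 / √n).trans ha
  have hb0 : 0 < b := ha0.trans_le hab
  have hna : 1 < √n * a := by rwa [div_lt_iff₀' hn0] at ha
  have hH := abs_pairing_jacobiOp_le hK hsupp hτ hβ h
  -- The factor `2` keeps the interval for `1 / (√n u)` nondegenerate when `a = b`.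
  have hc : 0 < 1 / (2 * (√n * b)) := by positivity
  have hcd : 1 / (2 * (√n * b)) < 1 / (√n * a) := by
    refine one_div_lt_one_div_of_lt (by positivity) ?_
    have := mul_le_mul_of_nonneg_left hab hn0.le
    have : 0 < √n * a := by positivity
    linarith
  have hd : 1 / (√n * a) < 1 := by rwa [div_lt_one (by positivity)]
  have hmem : ∀ u ∈ Set.Icc a b,
      1 / (√n * u) ∈ Set.Icc (1 / (2 * (√n * b))) (1 / (√n * a)) := by
    intro u hu
    have hu0 : 0 < u := ha0.trans_le hu.1
    have hub := mul_le_mul_of_nonneg_left hu.2 hn0.le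
    have : 0 < √n * b := by positivity
    exact ⟨one_div_le_one_div_of_le (by positivity) (by linarith),
      one_div_le_one_div_of_le (by positivity) (mul_le_mul_of_nonneg_left hu.1 hn0.le)⟩
  obtain ⟨B, hB, hBle⟩ := exists_summable_bound hβ _ hH hc hcd hd
  refine convergesUniformlyAbsolutelyOn_of_bound (hB.mul_left ((√n * b) ^ τ))
    (fun k u hu => ?_) fun u hu => ?_
  · have hu0 : 0 < u := ha0.trans_le hu.1
    rw [ht, abs_mul, abs_of_nonneg (by positivity)]
    exact mul_le_mul (Real.rpow_le_rpow (by positivity)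
      (mul_le_mul_of_nonneg_left hu.2 hn0.le) hτ) (hBle k _ (hmem u hu)) (abs_nonneg _)
      (by positivity)
  · have hu0 : 0 < u := ha0.trans_le hu.1
    have hx := hmem u hu
    have hs := (hasSum_jacobiSeries hβ _ hH (hc.trans_le hx.1) (hx.2.trans_lt hd)).mul_left
      ((√n * u) ^ τ)
    simp only [ht]
    -- The prefactor `(√n u) ^ τ` cancels the `x ^ τ` in the expanded function at `x = 1 / (√n u)`.
    rwa [← mul_assoc, ← Real.mul_rpow (by positivity) (by positivity),
      mul_one_div_cancel (by positivity), Real.one_rpow, one_mul, ← hcdf hu0] at hs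

/-- The factors `A + k`, the binomial coefficient and the normalization of `jacobiG` multiply to `A
+ 2k`, the reciprocal of the squared norm, because `(A + k)(A + k + 1)_k = (A + k)_k (A + 2k)`. -/
theorem jacobiTerm_eq {A : ℝ} (hA : 0 < A) (M : ℝ → ℝ) (k : ℕ) (x : ℝ) :
    (-1) ^ k * (A + k) * Ring.choose (A + 2 * k) k *
      (∑ j ∈ range (k + 1), (-1) ^ j *
        (risingFactorial (A + j) k / ((j.factorial : ℝ) * ((k - j).factorial : ℝ))) *
        (M (A + j) / (A + j))) * jacobiG k A A x =
    (A + 2 * k) * (∑ j ∈ range (k + 1), (jacobiPoly A k).coeff j * (M (A + j) / (A + j))) *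
      (jacobiPoly A k).eval x := by
  have hsum : ∑ j ∈ range (k + 1), (-1) ^ j *
        (risingFactorial (A + j) k / ((j.factorial : ℝ) * ((k - j).factorial : ℝ))) *
        (M (A + j) / (A + j)) =
      ∑ j ∈ range (k + 1), (jacobiPoly A k).coeff j * (M (A + j) / (A + j)) :=
    Finset.sum_congr rfl fun j hj => by
      rw [coeff_jacobiPoly_of_le (by simpa [Nat.lt_succ_iff] using hj)]
  have hasc := ascPochhammer_pos k (A + k) (by positivity)
  have hshift := ascPochhammer_eval_shift k (A + k)
  have hk : (k.factorial : ℝ) ≠ 0 := by positivity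
  have hsq : ((-1 : ℝ)) ^ k * (-1) ^ k = 1 := by rw [← mul_pow]; simp
  rw [hsum, jacobiG_eq hA, ringChoose_eq, show A + 2 * (k : ℝ) - k + 1 = A + k + 1 by ring]
  set S := ∑ j ∈ range (k + 1), (jacobiPoly A k).coeff j * (M (A + j) / (A + j))
  set Q := (jacobiPoly A k).eval x
  have hpre : (A + k) * ((ascPochhammer ℝ k).eval (A + k + 1) / k.factorial) *
      (k.factorial / (ascPochhammer ℝ k).eval (A + k)) = A + 2 * k := by
    field_simp
    rw [hshift]; ring
  linear_combination (((-1 : ℝ) ^ k * (-1) ^ k) * S * Q) * hpre + ((A + 2 * k) * S * Q) * hsq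

theorem legendreTerm_eq (M : ℕ → ℝ) (k : ℕ) (x : ℝ) :
    (-1) ^ k * (2 * k + 1) *
      (∑ j ∈ range (k + 1), (-1) ^ j *
        (risingFactorial ((k : ℝ) - j + 1) (2 * j) / ((j.factorial : ℝ) * (j.factorial : ℝ))) *
        M j) * legendreStar k x =
    (1 + 2 * k) * (∑ j ∈ range (k + 1), (jacobiPoly 1 k).coeff j * M j) *
      (jacobiPoly 1 k).eval x := by
  have hsum : ∑ j ∈ range (k + 1), (-1) ^ j *
        (risingFactorial ((k : ℝ) - j + 1) (2 * j) / ((j.factorial : ℝ) * (j.factorial : ℝ))) *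
        M j = ∑ j ∈ range (k + 1), (jacobiPoly 1 k).coeff j * M j :=
    Finset.sum_congr rfl fun j hj => by
      rw [coeff_jacobiPoly_one_of_le (by simpa [Nat.lt_succ_iff] using hj)]
  have hsq : ((-1 : ℝ)) ^ k * (-1) ^ k = 1 := by rw [← mul_pow]; simp
  rw [hsum, legendreStar_eq]
  linear_combination ((1 + 2 * k) * (∑ j ∈ range (k + 1), (jacobiPoly 1 k).coeff j * M j) *
    (jacobiPoly 1 k).eval x) * hsq

end GammaAngle

theorem theorem1 {Ω : Type*} [MeasurableSpace Ω] (P : Measure Ω) [IsProbabilityMeasure P]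
    (n : ℕ) (α : ℝ) (hα : 0 < α) (X : Fin n → Ω → ℝ)
    (hlaw : ∀ i, HasLaw (X i) (gammaMeasure α 1) P) (hindep : iIndepFun X P) :
    (max 2 (1 + 1 / (2 * α)) < (n : ℝ) →
      ∀ a b : ℝ, 1 / Real.sqrt n < a → a ≤ b → b < 1 →
        DirichletSquareSum.ConvergesUniformlyAbsolutelyOn
          (fun k u => DirichletSquareSum.jacobiTerm P X α k u)
          (fun u => cdf (P.map (DirichletSquareSum.statU X)) u)
          (Set.Icc a b)) ∧
    (max (max 2 (1 + 1 / (2 * α))) (3 / (2 * α)) < (n : ℝ) →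
      ∀ a b : ℝ, 1 / Real.sqrt n < a → a ≤ b → b < 1 →
        DirichletSquareSum.ConvergesUniformlyAbsolutelyOn
          (fun k u => (Real.sqrt n * u) ^ (α * n - 1) * DirichletSquareSum.legendreTerm P X α k u)
          (fun u => cdf (P.map (DirichletSquareSum.statU X)) u)
          (Set.Icc a b)) := by
  have hcond : max 2 (1 + 1 / (2 * α)) < (n : ℝ) → 3 ≤ n ∧ 1 / (2 * ((n : ℝ) - 1)) < α := by
    intro h
    obtain ⟨h1, h2⟩ := max_lt_iff.1 h
    have h3 : 2 < n := by exact_mod_cast h1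
    refine ⟨h3, ?_⟩
    rw [← lt_sub_iff_add_lt', div_lt_iff₀ (by positivity)] at h2
    rw [div_lt_iff₀ (by linarith)]
    linarith
  refine ⟨fun h a b ha hab _ => ?_, fun h a b ha hab _ => ?_⟩
  · obtain ⟨hn, hα'⟩ := hcond h
    have hA : 0 < α * n := mul_pos hα (by exact_mod_cast (by omega : 0 < n))
    -- Here `τ = 0` and `β = α n`: the tail function itself is expanded.
    refine GammaAngle.convergesUniformlyAbsolutelyOn_cdf_statU hn hα' hlaw hindep le_rfl hA
      (Or.inl rfl) ha hab fun k u => ?_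
    rw [Real.rpow_zero, one_mul, DirichletSquareSum.jacobiTerm,
      GammaAngle.jacobiTerm_eq hA (DirichletSquareSum.cosMoment P X)]
    simp only [zero_add]
  · obtain ⟨h1, h2⟩ := max_lt_iff.1 h
    obtain ⟨hn, hα'⟩ := hcond h1
    have hA : 3 / 2 < α * n := by
      rw [div_lt_iff₀ (by positivity)] at h2
      linarith
    -- With `β = 1` the weight is constant, and `τ = α n - 1` makes `τ + β + j` equal to `α n + j`,
    -- so the same moments appear. The condition `2 ≤ 2τ + β` becomes `3/2 ≤ α n`.
    refine GammaAngle.convergesUniformlyAbsolutelyOn_cdf_statU (τ := α * n - 1) hn hα' hlaw hindep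
      (by linarith) one_pos (Or.inr (by linarith)) ha hab fun k u => ?_
    rw [DirichletSquareSum.legendreTerm, sub_add_cancel, GammaAngle.legendreTerm_eq
      fun j => DirichletSquareSum.cosMoment P X (α * n + j) / (α * n + j)]
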